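/- Let $a_1,\dots,a_N$ be complex $n\times n$ matrices obeying the canonical anticommutation relations $a_k^\dagger a_l+a_la_k^\dagger=\delta_{kl}\mathbb 1$, $a_ka_l+a_la_k=0$ (fermionic mode operators on a finite-dimensional Hilbert space), and let $c_{2j-1}=a_j^\dagger+a_j$, $c_{2j}=-i(a_j^\dagger-a_j)$ be the $2N$ Majorana operators. A state is a positive semidefinite matrix of trace $1$. Let $\mathcal V_G$ be the set of all states of the form $\kappa\exp[-\tfrac i2\sum_{k,l}K_{kl}c_kc_l]$ with $\kappa\in\mathbb R$ and $K=-K^T\in\mathbb R^{2N\times 2N}$ (the full-rank fermionic Gaussian states). For $\rho\in\mathcal V_G$ let $T_\rho\mathcal V_G$ be its tangent space, i.e. the real span of the velocities $\dot\gamma(0)$ of curves $\gamma$ in $\mathcal V_G$ that are differentiable at $0$ with $\gamma(0)=\rho$. The covariance matrix of a state $\sigma$ is $\Gamma(\sigma)_{kl}=\tfrac i2\operatorname{tr}([c_k,c_l]\sigma)$, and a Gaussification of $\sigma$ is a $\mathcal G(\sigma)\in\mathcal V_G$ with $\Gamma(\mathcal G(\sigma))=\Gamma(\sigma)$. Let $(\mathcal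 E_t)_{t\ge0}$ be a differentiable Markovian evolution: completely positive trace-preserving linear maps on the $n\times n$ matrices with $\mathcal E_0=\mathrm{id}$, $\mathcal E_{s+t}=\mathcal E_s\mathcal E_t$, and $\partial_t\rho_t=\mathcal L(\rho_t)$ for all $\rho_t=\mathcal E_t(\rho_0)$, where the generator $\mathcal L$ is linear. For $\rho\in\mathcal V_G$ and $\alpha\in\mathbb R$ put $$\Omega^\alpha_\rho(\sigma)=\tfrac12\left(\rho^{-\alpha}\sigma\rho^{\alpha-1}+\rho^{\alpha-1}\sigma\rho^{-\alpha}\right).$$ Then for every $\rho\in\mathcal V_G$ there is an $A\in T_\rho\mathcal V_G$ such that: 1. for every convex combination $\Omega$ of the superoperators $\Omega^\alpha_\rho$, $\alpha\in\mathbb R$, $A$ is the unique minimizer over $B\in T_\rho\mathcal V_G$ of $\operatorname{tr}[(B-\mathcal L(\rho))^\dagger\,\Omega(B-\mathcal L(\rho))]$ (so the locally optimal projection of $\mathcal L(\rho)$ onto $T_\rho\mathcal V_G$ is the same for all these metrics); 2. for every basis $(\partial_j\rho)_j$ of the real vector space $T_\rho\mathcal V_G$ one has $A=\sum_jv^j\partial_j\rho$,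 where $v$ is the unique real solution of $$\operatorname{tr}[c_{k_1}c_{k_2}\mathcal L(\rho)]=\sum_jv^j\operatorname{tr}[c_{k_1}c_{k_2}\partial_j\rho]\qquad\text{for all }k_1,k_2;$$ 3. $A$ is the velocity of the Gaussified evolution: for all sufficiently small $s\ge0$ the states $\mathcal E_s(\rho)$ and $\rho+s\mathcal L(\rho)$ have unique Gaussifications, and the curves $s\mapsto\mathcal G(\mathcal E_s(\rho))$ and $s\mapsto\mathcal G(\rho+s\mathcal L(\rho))$ both have right derivative $A$ at $s=0$. -/

import Mathlib

open scoped Topology ComplexOrder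

noncomputable section

namespace FermionTDVP

variable {N : ℕ} {n : Type*} [Fintype n] [DecidableEq n]

/-! ### States and Markovian evolutions -/

/-- Density matrices: positive semidefinite (hence Hermitian) of unit trace. -/
def IsState (ρ : Matrix n n ℂ) : Prop :=
  ρ.PosSemidef ∧ ρ.trace = 1

/-- The ampliation `id_m ⊗ Φ` of a superoperator `Φ`, acting on `m × m` block matrices with
blocks in `Matrix n n ℂ`. -/
def ampliation (m : ℕ) (Φ : Matrix n n ℂ →ₗ[ℂ] Matrix n n ℂ)
    (X : Matrix (Fin m × n) (Fin m × n) ℂ) : Matrix (Fin m × n) (Fin m × n) ℂ :=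
  Matrix.of fun p q => Φ (Matrix.of fun i j => X (p.1, i) (q.1, j)) p.2 q.2

/-- Completely positive trace-preserving maps. -/
def IsCPT (Φ : Matrix n n ℂ →ₗ[ℂ] Matrix n n ℂ) : Prop :=
  (∀ (m : ℕ) (X : Matrix (Fin m × n) (Fin m × n) ℂ),
      X.PosSemidef → (ampliation m Φ X).PosSemidef) ∧
    ∀ X : Matrix n n ℂ, (Φ X).trace = X.trace

/-- `E t`, `t ≥ 0`, is a differentiable Markovian (semigroup) evolution by CPT maps with
generator `L`: the curves `ρ_t = E t ρ₀` solve `∂ₜ ρ_t = L ρ_t`. -/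
structure IsMarkovianEvolution (E : ℝ → (Matrix n n ℂ →ₗ[ℂ] Matrix n n ℂ))
    (L : Matrix n n ℂ →ₗ[ℂ] Matrix n n ℂ) : Prop where
  cpt : ∀ t, 0 ≤ t → IsCPT (E t)
  zero : E 0 = LinearMap.id
  add : ∀ s t, 0 ≤ s → 0 ≤ t → E (s + t) = E s ∘ₗ E t
  deriv : ∀ (ρ₀ : Matrix n n ℂ) (t : ℝ), 0 ≤ t →
    HasDerivWithinAt (fun s => E s ρ₀) (L (E t ρ₀)) (Set.Ici 0) t

/-! ### Fermionic modes and Gaussian states -/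

/-- Canonical anticommutation relations for `N` fermionic mode operators. -/
structure IsCAR (a : Fin N → Matrix n n ℂ) : Prop where
  anticomm_star : ∀ k l, (a k).conjTranspose * a l + a l * (a k).conjTranspose
    = if k = l then 1 else 0
  anticomm : ∀ k l, a k * a l + a l * a k = 0

/-- The `2N` Majorana operators: `majorana a (j, 0) = a_j† + a_j` and
`majorana a (j, 1) = -i (a_j† - a_j)`. -/
def majorana (a : Fin N → Matrix n n ℂ) (k : Fin N × Fin 2) : Matrix n n ℂ :=
  if k.2 = 0 then (a k.1).conjTranspose + a k.1
  else (-Complex.I) • ((a k.1).conjTranspose - a k.1)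

/-- The quadratic expression `-(i/2) cᵀ K c`. -/
def quadraticForm (a : Fin N → Matrix n n ℂ) (K : Matrix (Fin N × Fin 2) (Fin N × Fin 2) ℝ) :
    Matrix n n ℂ :=
  (-(Complex.I / 2)) • ∑ k, ∑ l, (K k l : ℂ) • (majorana a k * majorana a l)

/-- The set `V_G` of full-rank fermionic Gaussian states: the density matrices of the form
`κ exp(-(i/2) cᵀ K c)` with `K` real and antisymmetric. -/
def gaussianStates (a : Fin N → Matrix n n ℂ) : Set (Matrix n n ℂ) :=
  {ρ | IsState ρ ∧ ∃ (κ : ℝ) (K : Matrix (Fin N × Fin 2) (Fin N × Fin 2) ℝ),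
    K.transpose = -K ∧ ρ = (κ : ℂ) • NormedSpace.exp (quadraticForm a K)}

/-- The covariance matrix `Γ_{kl} = (i/2) tr([c_k, c_l] ρ)`. -/
def covariance (a : Fin N → Matrix n n ℂ) (ρ : Matrix n n ℂ) :
    Matrix (Fin N × Fin 2) (Fin N × Fin 2) ℂ :=
  Matrix.of fun k l => (Complex.I / 2) *
    ((majorana a k * majorana a l - majorana a l * majorana a k) * ρ).trace

/-- `ρG` is a Gaussification of the state `σ`: the Gaussian state with the same covariance
matrix. -/
def IsGaussification (a : Fin N → Matrix n n ℂ) (σ ρG : Matrix n n ℂ) : Prop :=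
  IsState σ ∧ ρG ∈ gaussianStates a ∧ covariance a ρG = covariance a σ

/-- `A` is the velocity at time `0` of the Gaussified curve `s ↦ 𝒢(σ s)`, `s ≥ 0`: for all small
`s ≥ 0` the Gaussification of `σ s` exists and is unique, and the resulting curve has right
derivative `A` at `0`. -/
def IsGaussifiedVelocity (a : Fin N → Matrix n n ℂ) (σ : ℝ → Matrix n n ℂ)
    (A : Matrix n n ℂ) : Prop :=
  (∀ᶠ s in 𝓝[≥] (0 : ℝ), ∃! ρG, IsGaussification a (σ s) ρG) ∧
    ∀ γ : ℝ → Matrix n n ℂ, (∀ᶠ s in 𝓝[≥] (0 : ℝ), IsGaussification a (σ s) (γ s)) →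
      HasDerivWithinAt γ A (Set.Ici 0) 0

/-! ### Tangent spaces, metrics and the variational principle -/

/-- The (real) tangent space at `ρ` of a set `V` of matrices: the span of the velocities at `ρ`
of the curves in `V` through `ρ`. -/
def tangentSpace (V : Set (Matrix n n ℂ)) (ρ : Matrix n n ℂ) : Submodule ℝ (Matrix n n ℂ) :=
  Submodule.span ℝ {A | ∃ γ : ℝ → Matrix n n ℂ, (∀ s, γ s ∈ V) ∧ γ 0 = ρ ∧ HasDerivAt γ A 0}

/-- The real power `ρ ^ α` of a positive definite matrix, by functional calculus. -/
def matPow (ρ : Matrix n n ℂ) (α : ℝ) : Matrix n n ℂ :=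
  cfc (fun x : ℝ => x ^ α) ρ

/-- The superoperator `Ω_ρ^α(σ) = ½ (ρ^{-α} σ ρ^{α-1} + ρ^{α-1} σ ρ^{-α})`. -/
def alphaMetric (ρ : Matrix n n ℂ) (α : ℝ) : Matrix n n ℂ →ₗ[ℂ] Matrix n n ℂ :=
  (1 / 2 : ℂ) • (LinearMap.mulLeftRight ℂ (matPow ρ (-α), matPow ρ (α - 1)) +
    LinearMap.mulLeftRight ℂ (matPow ρ (α - 1), matPow ρ (-α)))

/-- The superoperators of `α`-norm type at `ρ` and all their convex combinations. -/
def alphaMetrics (ρ : Matrix n n ℂ) : Set (Matrix n n ℂ →ₗ[ℂ] Matrix n n ℂ) :=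
  convexHull ℝ (Set.range (alphaMetric ρ))

/-- The squared length `⟨A, Ω(A)⟩ = tr(A† Ω(A))`. The value is real for the superoperators of
`alphaMetrics`; the real part only changes its type. -/
def sqLength (Ω : Matrix n n ℂ →ₗ[ℂ] Matrix n n ℂ) (A : Matrix n n ℂ) : ℝ :=
  (A.conjTranspose * Ω A).trace.re

/-- `A` is an element of `T` closest to `X` in the metric given by `Ω`. -/
def IsTDVPProjection (Ω : Matrix n n ℂ →ₗ[ℂ] Matrix n n ℂ) (T : Submodule ℝ (Matrix n n ℂ))
    (X A : Matrix n n ℂ) : Prop :=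
  A ∈ T ∧ ∀ B ∈ T, sqLength Ω (A - X) ≤ sqLength Ω (B - X)

end FermionTDVP

end

/-! Write ρ = e^H with H in the real space Q (`quadSpace`) spanned by 1 and the Hermitian quadratic
forms; the multiple of 1 absorbs κ. Let S (`quadSpan`) be the complex span of 1 and the products c_k
c_l. Tangent vectors are the traceless derivatives d exp_H(y) with y ∈ Q.

The anticommutation relations make S closed under commutators, hence stable under conjugation by
e^{tH}. Duhamel's formula d exp_H(y) = (∫₀¹ e^{tH} y e^{-tH} dt) e^H then puts tangent vectors in
the form W e^H with W ∈ S. The two exponents in Ω^α sum to -1, so Ω^α(W e^H) is an average of two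
conjugates of W and lies in S for every α (`isMetricInto_alphaMetric`). Hence one tangent vector A
with A - L(ρ) trace-orthogonal to S is the projection for all metrics, by Pythagoras.

The rest follows from one positivity: tr(y d exp_H(y)) > 0 for Hermitian y ≠ 0
(`tracial_mul_fderiv_exp_pos`). It makes y ↦ tr(· d exp_H(y)) an isomorphism Q → Q*, so quadratic
moments can be prescribed on derivatives and, by the inverse function theorem, along curves
(`exists_exp_curve_of_moments`). Integrated along segments, it shows that the moments determine e^Y
globally (`eq_of_tracial_exp_eq`). A Gaussification matches exactly these moments, so its velocity
depends only on the moments of L(ρ). -/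

open scoped Topology ComplexOrder

namespace FermionTDVP

/-! ### Duhamel's formula and conjugation by exponentials in a Banach algebra. -/

section BanachAlgebra

open NormedSpace

variable {𝔸 : Type*} [NormedRing 𝔸] [NormedAlgebra ℝ 𝔸] [CompleteSpace 𝔸]

theorem continuous_exp_real_algebra : Continuous (exp : 𝔸 → 𝔸) :=
  continuous_iff_continuousAt.2 fun x => (exp_analytic (𝕂 := ℝ) x).continuousAt

theorem exp_smul_mul_exp_smul (x : 𝔸) (s t : ℝ) :
    exp (s • x) * exp (t • x) = exp ((s + t) • x) := by
  let _ : NormedAlgebra ℚ 𝔸 := NormedAlgebra.restrictScalars ℚ ℝ 𝔸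
  rw [add_smul, exp_add_of_commute]
  exact ((Commute.refl x).smul_left s).smul_right t

/-- The integral `∫₀¹ e^{t(H + εY)} Y e^{-tH} dt`. -/
noncomputable def duhamelIntegral (H Y : 𝔸) (ε : ℝ) : 𝔸 :=
  ∫ t in (0 : ℝ)..1, exp (t • (H + ε • Y)) * Y * exp ((-t) • H)

theorem continuous_duhamelIntegral (H Y : 𝔸) : Continuous (duhamelIntegral H Y) := by
  refine intervalIntegral.continuous_parametric_intervalIntegral_of_continuous' ?_ 0 1
  have := continuous_exp_real_algebra (𝔸 := 𝔸)
  simp only [Function.uncurry_def]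
  fun_prop

/-- Duhamel's formula for a finite increment of the exponential. -/
theorem exp_add_smul_eq_duhamel (H Y : 𝔸) (ε : ℝ) :
    exp (H + ε • Y) = exp H + ε • (duhamelIntegral H Y ε * exp H) := by
  have hexp := continuous_exp_real_algebra (𝔸 := 𝔸)
  -- The derivative of e^{t(H+εY)} e^{-tH} is ε times the integrand; integrate it over [0, 1].
  have hd : ∀ t ∈ Set.uIcc (0 : ℝ) 1,
      HasDerivAt (fun t : ℝ => exp (t • (H + ε • Y)) * exp ((-t) • H))
        (ε • (exp (t • (H + ε • Y)) * Y * exp ((-t) • H))) t := by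
    intro t _
    have h1 := hasDerivAt_exp_smul_const (𝕂 := ℝ) (H + ε • Y) t
    have h2 : HasDerivAt (fun t : ℝ => exp ((-t) • H)) (-(H * exp ((-t) • H))) t := by
      have := (hasDerivAt_exp_smul_const' (𝕂 := ℝ) H (-t)).scomp t (hasDerivAt_neg t)
      simpa [Function.comp_def] using this
    refine (h1.mul h2).congr_deriv ?_
    simp only [mul_add, add_mul, mul_neg, mul_smul_comm, smul_mul_assoc, mul_assoc]
    abel
  have hi := intervalIntegral.integral_eq_sub_of_hasDerivAt hd
    (Continuous.intervalIntegrable (by fun_prop) _ _)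
  rw [intervalIntegral.integral_smul] at hi
  have h0 : exp (-H) * exp H = 1 := by
    simpa using exp_smul_mul_exp_smul H (-1) 1
  have hi' : ε • duhamelIntegral H Y ε = exp (H + ε • Y) * exp (-H) - 1 := by
    simpa [duhamelIntegral] using hi
  rw [← smul_mul_assoc, hi', sub_mul, mul_assoc, h0]
  simp

/-- Duhamel's formula for the derivative of the exponential. -/
theorem fderiv_exp_apply (H Y : 𝔸) :
    fderiv ℝ (exp : 𝔸 → 𝔸) H Y = duhamelIntegral H Y 0 * exp H := by
  have h1 : HasDerivAt (fun ε : ℝ => exp (H + ε • Y)) (fderiv ℝ (exp : 𝔸 → 𝔸) H Y) 0 := by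
    have hf : HasFDerivAt (exp : 𝔸 → 𝔸) (fderiv ℝ exp H) (H + (0 : ℝ) • Y) := by
      simpa using (exp_analytic (𝕂 := ℝ) H).differentiableAt.hasFDerivAt
    have hl : HasDerivAt (fun ε : ℝ => H + ε • Y) Y 0 := by
      simpa using ((hasDerivAt_id (0 : ℝ)).smul_const Y).const_add H
    exact hf.comp_hasDerivAt (0 : ℝ) hl
  have h2 : HasDerivAt (fun ε : ℝ => exp (H + ε • Y)) (duhamelIntegral H Y 0 * exp H) 0 := by
    rw [hasDerivAt_iff_tendsto_slope_zero]
    have hc : Filter.Tendsto (fun ε : ℝ => duhamelIntegral H Y ε * exp H) (𝓝[≠] 0)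
        (𝓝 (duhamelIntegral H Y 0 * exp H)) :=
      (((continuous_duhamelIntegral H Y).mul continuous_const).tendsto 0).mono_left
        nhdsWithin_le_nhds
    refine hc.congr' ?_
    filter_upwards [self_mem_nhdsWithin] with ε hε
    have hε : ε ≠ 0 := hε
    simp [exp_add_smul_eq_duhamel H Y ε, smul_smul, inv_mul_cancel₀ hε]
  exact h1.unique h2

/-- A closed real subspace that contains all `e^{tH} Y e^{-tH}` contains their mean. -/
theorem duhamelIntegral_mem (H Y : 𝔸) (S : Submodule ℝ 𝔸) (hS : IsClosed (S : Set 𝔸))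
    (h : ∀ t : ℝ, exp (t • H) * Y * exp ((-t) • H) ∈ S) : duhamelIntegral H Y 0 ∈ S := by
  have hexp := continuous_exp_real_algebra (𝔸 := 𝔸)
  rw [duhamelIntegral, intervalIntegral.integral_of_le zero_le_one]
  -- On an interval of length 1 the integral is an average, which stays in a closed convex set.
  have : MeasureTheory.IsProbabilityMeasure
      (MeasureTheory.volume.restrict (Set.Ioc (0 : ℝ) 1)) := ⟨by simp⟩
  refine Convex.integral_mem S.convex hS ?_ ?_
  · exact Filter.Eventually.of_forall fun t => by simpa using h t
  · have : IntervalIntegrable (fun t : ℝ => exp (t • (H + (0 : ℝ) • Y)) * Y * exp ((-t) • H))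
        MeasureTheory.volume 0 1 := Continuous.intervalIntegrable (by fun_prop) _ _
    exact (intervalIntegrable_iff_integrableOn_Ioc_of_le zero_le_one).1 this

/-- Linear differential equations with constant coefficients have global solutions. -/
theorem exists_hasDerivAt_clm {E : Type*} [NormedAddCommGroup E] [NormedSpace ℝ E]
    [CompleteSpace E] (T : E →L[ℝ] E) (y : E) :
    ∃ u : ℝ → E, u 0 = y ∧ ∀ r, HasDerivAt u (T (u r)) r := by
  refine ⟨fun r => exp (r • T) y, by simp, fun r => ?_⟩
  have h := (hasDerivAt_exp_smul_const' (𝕂 := ℝ) T r).clm_apply (hasDerivAt_const r y)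
  simpa using h

/-- A finite-dimensional subspace stable under `ad H` is stable under conjugation by `e^{tH}`. -/
theorem exp_conj_mem [FiniteDimensional ℝ 𝔸] (H : 𝔸) (S : Submodule ℝ 𝔸)
    (hS : ∀ X ∈ S, H * X - X * H ∈ S) (Y : 𝔸) (hY : Y ∈ S) (t : ℝ) :
    exp (t • H) * Y * exp ((-t) • H) ∈ S := by
  -- Solve u' = Hu - uH inside S with u(0) = Y. Then e^{-rH} u(r) e^{rH} is constant, so u(t) is the
  -- conjugate of Y and lies in S.
  let ad : S →L[ℝ] S := LinearMap.toContinuousLinearMap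
    ((LinearMap.mulLeft ℝ H - LinearMap.mulRight ℝ H).restrict hS)
  have had (X : S) : (ad X : 𝔸) = H * X - X * H := rfl
  obtain ⟨u, hu0, hu'⟩ := exists_hasDerivAt_clm ad ⟨Y, hY⟩
  have hu (r : ℝ) : HasDerivAt (fun r => (u r : 𝔸)) (H * u r - u r * H) r :=
    S.subtypeL.hasFDerivAt.comp_hasDerivAt r (hu' r)
  have hconst (r : ℝ) : HasDerivAt
      (fun r : ℝ => exp ((-r) • H) * (u r : 𝔸) * exp (r • H)) 0 r := by
    have h1 := hasDerivAt_exp_smul_const' (𝕂 := ℝ) H r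
    have h2 : HasDerivAt (fun t : ℝ => exp ((-t) • H)) (-(exp ((-r) • H) * H)) r := by
      have := (hasDerivAt_exp_smul_const (𝕂 := ℝ) H (-r)).scomp r (hasDerivAt_neg r)
      simpa [Function.comp_def] using this
    refine ((h2.mul (hu r)).mul h1).congr_deriv ?_
    simp only [Pi.mul_apply]
    noncomm_ring
  have heq := is_const_of_deriv_eq_zero (fun r => (hconst r).differentiableAt)
    (fun r => (hconst r).deriv) t 0
  have h0 : exp (t • H) * exp ((-t) • H) = 1 := by
    simpa using exp_smul_mul_exp_smul H t (-t)
  have heq' : exp ((-t) • H) * (u t : 𝔸) * exp (t • H) = Y := by simpa [hu0] using heq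
  have : exp (t • H) * Y * exp ((-t) • H) = u t := by
    rw [← heq']
    calc _ = (exp (t • H) * exp ((-t) • H)) * u t * (exp (t • H) * exp ((-t) • H)) := by
          noncomm_ring
      _ = u t := by rw [h0, one_mul, mul_one]
  rw [this]
  exact (u t).2

end BanachAlgebra

/-- Positivity makes `f'` injective, equality of dimensions makes it bijective, and the inverse
function theorem applies. In the application `f` sends an exponent to the moments of its
exponential. -/
theorem exists_right_inverse_of_hasStrictFDerivAt_dual {E : Type*} [NormedAddCommGroup E]
    [NormedSpace ℝ E] [FiniteDimensional ℝ E] {f : E → E →L[ℝ] ℝ} {f' : E →L[ℝ] E →L[ℝ] ℝ}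
    {x : E} (hf : HasStrictFDerivAt f f' x) (hpos : ∀ y, y ≠ 0 → 0 < f' y y) :
    ∃ (h : (E →L[ℝ] ℝ) → E) (h' : (E →L[ℝ] ℝ) →L[ℝ] E), h (f x) = x ∧
      HasFDerivAt h h' (f x) ∧ (∀ᶠ z in 𝓝 (f x), f (h z) = z) ∧ ∀ z, f' (h' z) = z := by
  have hinj : Function.Injective f' := by
    refine (injective_iff_map_eq_zero f').2 fun y hy => ?_
    by_contra hne
    have := hpos y hne
    simp [hy] at this
  have hrank : Module.finrank ℝ E = Module.finrank ℝ (E →L[ℝ] ℝ) := by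
    rw [← (LinearMap.toContinuousLinearMap (𝕜 := ℝ) (E := E) (F' := ℝ)).finrank_eq]
    exact (Subspace.dual_finrank_eq (K := ℝ) (V := E)).symm
  let e : E ≃L[ℝ] (E →L[ℝ] ℝ) :=
    (LinearEquiv.ofInjectiveOfFinrankEq f'.toLinearMap hinj hrank).toContinuousLinearEquiv
  have he : (e : E →L[ℝ] E →L[ℝ] ℝ) = f' := by ext; rfl
  have hf' : HasStrictFDerivAt f (e : E →L[ℝ] E →L[ℝ] ℝ) x := by rwa [he]
  refine ⟨hf'.localInverse f e x, e.symm, hf'.localInverse_apply_image,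
    hf'.to_localInverse.hasFDerivAt, hf'.eventually_right_inverse, fun z => ?_⟩
  rw [← he]
  simp

/-! ### Exponentials and moments in an algebra with a faithful positive trace. -/

section TracialAlgebra

open NormedSpace

variable {𝔸 : Type*} [NormedRing 𝔸] [NormedAlgebra ℝ 𝔸] [CompleteSpace 𝔸]

theorem hasFDerivAt_exp_fderiv (H : 𝔸) :
    HasFDerivAt (exp : 𝔸 → 𝔸) (fderiv ℝ exp H) H :=
  (exp_analytic (𝕂 := ℝ) _).differentiableAt.hasFDerivAt

theorem hasDerivAt_exp_add_smul (H Y : 𝔸) (t : ℝ) :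
    HasDerivAt (fun t : ℝ => exp (H + t • Y)) (fderiv ℝ exp (H + t • Y) Y) t := by
  have hl : HasDerivAt (fun ε : ℝ => H + ε • Y) Y t := by
    simpa using ((hasDerivAt_id t).smul_const Y).const_add H
  exact (hasFDerivAt_exp_fderiv _).comp_hasDerivAt t hl

/-- The derivative of the exponential at `H` maps a finite-dimensional space `S` stable under
`ad H` into `S e^H`. -/
theorem exists_fderiv_exp_eq_mul [FiniteDimensional ℝ 𝔸] (H : 𝔸) (S : Submodule ℝ 𝔸)
    (hS : ∀ X ∈ S, H * X - X * H ∈ S) (Y : 𝔸) (hY : Y ∈ S) :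
    ∃ W ∈ S, fderiv ℝ exp H Y = W * exp H :=
  ⟨_, duhamelIntegral_mem H Y S S.closed_of_finiteDimensional (exp_conj_mem H S hS Y hY),
    fderiv_exp_apply H Y⟩

/-- Normalising does not change a velocity along which the trace is stationary. -/
theorem hasDerivAt_inv_smul_exp (τ : 𝔸 →L[ℝ] ℝ) {H Y : 𝔸} (hH : τ (exp H) = 1)
    (hY : τ (fderiv ℝ exp H Y) = 0) :
    HasDerivAt (fun t : ℝ => (τ (exp (H + t • Y)))⁻¹ • exp (H + t • Y))
      (fderiv ℝ exp H Y) 0 := by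
  have h1 : HasDerivAt (fun t : ℝ => exp (H + t • Y)) (fderiv ℝ exp H Y) 0 := by
    simpa using hasDerivAt_exp_add_smul H Y 0
  have h2 : HasDerivAt (fun t : ℝ => τ (exp (H + t • Y))) 0 0 := by
    exact (τ.hasFDerivAt.comp_hasDerivAt 0 h1).congr_deriv hY
  have h3 := h2.inv (by simp [hH])
  refine (h3.smul h1).congr_deriv ?_
  simp [hH]

theorem exp_smul_half_mul_self (H : 𝔸) (t : ℝ) :
    exp ((t / 2) • H) * exp ((t / 2) • H) = exp (t • H) := by
  rw [exp_smul_mul_exp_smul, add_halves]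

theorem exp_add_smul_one (H : 𝔸) (t : ℝ) :
    exp (H + t • (1 : 𝔸)) = Real.exp t • exp H := by
  let _ : NormedAlgebra ℚ 𝔸 := NormedAlgebra.restrictScalars ℚ ℝ 𝔸
  rw [exp_add_of_commute ((Commute.one_right H).smul_right t), ← Algebra.algebraMap_eq_smul_one,
    ← algebraMap_exp_comm, ← Real.exp_eq_exp_ℝ, Algebra.algebraMap_eq_smul_one]
  simp

theorem exp_smul_mul_exp_neg_smul (H : 𝔸) (t : ℝ) :
    exp (t • H) * exp ((-t) • H) = 1 := by
  rw [exp_smul_mul_exp_smul]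
  simp

theorem exp_neg_smul_mul_exp_smul (H : 𝔸) (t : ℝ) :
    exp ((-t) • H) * exp (t • H) = 1 := by
  rw [exp_smul_mul_exp_smul]
  simp

/-- The moments `X ↦ τ (J X σ)` of `σ` along the range of `J`. -/
noncomputable def momentMap {E : Type*} [NormedAddCommGroup E] [NormedSpace ℝ E]
    (τ : 𝔸 →L[ℝ] ℝ) (J : E →L[ℝ] 𝔸) : 𝔸 →L[ℝ] E →L[ℝ] ℝ :=
  ((ContinuousLinearMap.compL ℝ E 𝔸 ℝ).flip J).comp
    ((ContinuousLinearMap.compL ℝ 𝔸 𝔸 ℝ τ).comp (ContinuousLinearMap.mul ℝ 𝔸).flip)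

variable [StarRing 𝔸] [StarModule ℝ 𝔸] [ContinuousStar 𝔸]

omit [CompleteSpace 𝔸] in
theorem isSelfAdjoint_exp_smul {H : 𝔸} (hH : IsSelfAdjoint H) (t : ℝ) :
    IsSelfAdjoint (exp (t • H)) := by
  have h : IsSelfAdjoint (t • H) := (IsSelfAdjoint.all t).smul hH
  rw [IsSelfAdjoint, star_exp, h.star_eq]

variable {τ : 𝔸 →L[ℝ] ℝ}

/-- By cyclicity this is the squared Hilbert-Schmidt length of e^{sH/2} A e^{tH/2}. It gives the
positivity both of Duhamel's integrand and of Ω^α. -/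
theorem tracial_star_mul_exp_mul_exp_pos (hτ : ∀ x y, τ (x * y) = τ (y * x))
    (hpos : ∀ x, x ≠ 0 → 0 < τ (star x * x)) {H : 𝔸} (hH : IsSelfAdjoint H)
    {A : 𝔸} (hA : A ≠ 0) (s t : ℝ) :
    0 < τ (star A * (exp (s • H) * A * exp (t • H))) := by
  set B := exp ((s / 2) • H) * A * exp ((t / 2) • H) with hB
  have hB0 : B ≠ 0 := by
    intro h0
    apply hA
    calc A = (exp ((-(s / 2)) • H) * exp ((s / 2) • H)) * A *
          (exp ((t / 2) • H) * exp ((-(t / 2)) • H)) := by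
          rw [exp_smul_mul_exp_neg_smul, exp_neg_smul_mul_exp_smul, one_mul, mul_one]
      _ = exp ((-(s / 2)) • H) * B * exp ((-(t / 2)) • H) := by rw [hB]; simp only [mul_assoc]
      _ = 0 := by rw [h0]; simp
  have htr : τ (star A * (exp (s • H) * A * exp (t • H))) = τ (star B * B) := by
    rw [hB, star_mul, star_mul, (isSelfAdjoint_exp_smul hH _).star_eq,
      (isSelfAdjoint_exp_smul hH _).star_eq, ← exp_smul_half_mul_self H s,
      ← exp_smul_half_mul_self H t, mul_assoc (exp ((t / 2) • H)), hτ (exp ((t / 2) • H))]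
    simp only [mul_assoc]
  rw [htr]
  exact hpos B hB0

/-- Strict convexity: the derivative of the exponential is positive definite. -/
theorem tracial_mul_fderiv_exp_pos (hτ : ∀ x y, τ (x * y) = τ (y * x))
    (hpos : ∀ x, x ≠ 0 → 0 < τ (star x * x)) {H Y : 𝔸} (hH : IsSelfAdjoint H)
    (hY : IsSelfAdjoint Y) (hY0 : Y ≠ 0) : 0 < τ (Y * fderiv ℝ exp H Y) := by
  have hexp := continuous_exp_real_algebra (𝔸 := 𝔸)
  have hint : IntervalIntegrable (fun t : ℝ => exp (t • (H + (0 : ℝ) • Y)) * Y * exp ((-t) • H))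
      MeasureTheory.volume 0 1 := Continuous.intervalIntegrable (by fun_prop) _ _
  let ℓ : 𝔸 →L[ℝ] ℝ := τ.comp ((ContinuousLinearMap.mul ℝ 𝔸 Y).comp
    ((ContinuousLinearMap.mul ℝ 𝔸).flip (exp H)))
  have hℓ (X : 𝔸) : ℓ X = τ (Y * (X * exp H)) := rfl
  rw [fderiv_exp_apply, ← hℓ, duhamelIntegral, ← ℓ.intervalIntegral_comp_comm hint]
  refine intervalIntegral.intervalIntegral_pos_of_pos_on
    (Continuous.intervalIntegrable (by fun_prop) _ _) (fun t _ => ?_) zero_lt_one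
  -- After absorbing e^H, the integrand is τ(Y e^{tH} Y e^{(1-t)H}).
  have h := tracial_star_mul_exp_mul_exp_pos hτ hpos hH hY0 t (1 - t)
  rw [hY.star_eq] at h
  have h1 : exp ((-t) • H) * exp H = exp ((1 - t) • H) := by
    have := exp_smul_mul_exp_smul H (-t) 1
    rwa [one_smul, neg_add_eq_sub] at this
  rw [hℓ, zero_smul, add_zero, mul_assoc _ _ (exp H), h1]
  exact h

/-- A self-adjoint `Y` is determined by the moments of `e^Y`. -/
theorem eq_of_tracial_exp_eq (hτ : ∀ x y, τ (x * y) = τ (y * x))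
    (hpos : ∀ x, x ≠ 0 → 0 < τ (star x * x)) {Y Z : 𝔸} (hY : IsSelfAdjoint Y)
    (hZ : IsSelfAdjoint Z) (h : τ ((Z - Y) * exp Y) = τ ((Z - Y) * exp Z)) : Y = Z := by
  by_contra hne
  have hne' : Z - Y ≠ 0 := sub_ne_zero.2 (Ne.symm hne)
  have hD : IsSelfAdjoint (Z - Y) := hZ.sub hY
  have hd (t : ℝ) : HasDerivAt (fun t : ℝ => τ ((Z - Y) * exp (Y + t • (Z - Y))))
      (τ ((Z - Y) * fderiv ℝ exp (Y + t • (Z - Y)) (Z - Y))) t :=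
    τ.hasFDerivAt.comp_hasDerivAt t ((hasDerivAt_exp_add_smul Y (Z - Y) t).const_mul _)
  -- The hypothesis equates the values of this function at t = 0 and t = 1.
  have hmono : StrictMono (fun t : ℝ => τ ((Z - Y) * exp (Y + t • (Z - Y)))) := by
    refine strictMono_of_deriv_pos fun t => ?_
    rw [(hd t).deriv]
    exact tracial_mul_fderiv_exp_pos hτ hpos (hY.add ((IsSelfAdjoint.all t).smul hD)) hD hne'
  have := hmono zero_lt_one
  simp [h] at this

/-- Curves of moments near those of `e^H` lift to curves of exponentials. -/
theorem exists_exp_curve_of_moments {E : Type*} [NormedAddCommGroup E] [NormedSpace ℝ E]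
    [FiniteDimensional ℝ E] (hτ : ∀ x y, τ (x * y) = τ (y * x))
    (hpos : ∀ x, x ≠ 0 → 0 < τ (star x * x)) (J : E →L[ℝ] 𝔸) (hJ : Function.Injective J)
    (hJs : ∀ X, IsSelfAdjoint (J X)) (x : E) {σ : ℝ → 𝔸}
    {σ' : 𝔸} {s : Set ℝ} (hσ : HasDerivWithinAt σ σ' s 0) (hσ0 : σ 0 = exp (J x)) :
    ∃ (Y : ℝ → E) (y : E),
      HasDerivWithinAt (fun t => exp (J (Y t))) (fderiv ℝ exp (J x) (J y)) s 0 ∧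
      (∀ᶠ t in 𝓝[s] 0, ∀ X, τ (J X * exp (J (Y t))) = τ (J X * σ t)) ∧
      ∀ X, τ (J X * fderiv ℝ exp (J x) (J y)) = τ (J X * σ') := by
  have hexp : HasStrictFDerivAt (exp : 𝔸 → 𝔸) (fderiv ℝ exp (J x)) (J x) := by
    have h : ContDiffAt ℝ 1 (exp : 𝔸 → 𝔸) (J x) := (exp_analytic (𝕂 := ℝ) _).contDiffAt
    exact h.hasStrictFDerivAt one_ne_zero
  let m := momentMap τ J
  have hg : HasStrictFDerivAt (fun Y : E => m (exp (J Y)))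
      (m.comp ((fderiv ℝ exp (J x)).comp J)) x := by
    have h1 : HasStrictFDerivAt J J x := J.hasStrictFDerivAt
    have h2 := hexp.comp x h1
    exact m.hasStrictFDerivAt.comp x h2
  -- The derivative of the moment map is the form (y, z) ↦ τ(J z · d exp(J y)), positive on the
  -- diagonal.
  obtain ⟨h, h', hx, hh, hev, hinv⟩ := exists_right_inverse_of_hasStrictFDerivAt_dual hg
    (fun y hy => tracial_mul_fderiv_exp_pos hτ hpos (hJs x) (hJs y)
      (fun h0 => hy (hJ (h0.trans (map_zero J).symm))))
  have hm : HasDerivWithinAt (fun t => m (σ t)) (m σ') s 0 :=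
    m.hasFDerivAt.comp_hasDerivWithinAt 0 hσ
  have hm0 : m (σ 0) = m (exp (J x)) := by rw [hσ0]
  have hhd : HasDerivWithinAt (fun t => h (m (σ t))) (h' (m σ')) s 0 := by
    rw [← hm0] at hh
    exact hh.comp_hasDerivWithinAt 0 hm
  have hY0 : h (m (σ 0)) = x := by rw [hm0, hx]
  refine ⟨fun t => h (m (σ t)), h' (m σ'), ?_, ?_, ?_⟩
  · have h1 : HasDerivWithinAt (fun t => J (h (m (σ t)))) (J (h' (m σ'))) s 0 :=
      J.hasFDerivAt.comp_hasDerivWithinAt 0 hhd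
    have h2 : HasFDerivAt (exp : 𝔸 → 𝔸) (fderiv ℝ exp (J x)) (J (h (m (σ 0)))) := by
      rw [hY0]; exact hexp.hasFDerivAt
    exact h2.comp_hasDerivWithinAt 0 h1
  · have ht : Filter.Tendsto (fun t => m (σ t)) (𝓝[s] 0) (𝓝 (m (exp (J x)))) := by
      rw [← hm0]; exact hm.continuousWithinAt
    filter_upwards [ht.eventually hev] with t ht X
    exact congrArg (fun φ => φ X) ht
  · intro X
    exact congrArg (fun φ => φ X) (hinv (m σ'))

end TracialAlgebra

/-- Powers are continuous on the positive set exp(spectrum), so the two functional calculi compose.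
This turns the powers of ρ in Ω^α into exponentials of H. -/
theorem cfc_rpow_exp {𝔸 : Type*} [NormedRing 𝔸] [StarRing 𝔸] [NormedAlgebra ℝ 𝔸]
    [StarModule ℝ 𝔸] [ContinuousFunctionalCalculus ℝ 𝔸 IsSelfAdjoint] {H : 𝔸}
    (hH : IsSelfAdjoint H) (t : ℝ) :
    cfc (fun x : ℝ => x ^ t) (NormedSpace.exp H) = NormedSpace.exp (t • H) := by
  have hc : ContinuousOn (fun x : ℝ => x ^ t) (Set.image Real.exp (spectrum ℝ H)) := by
    rintro _ ⟨x, -, rfl⟩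
    exact (Real.continuousAt_rpow_const _ _ (Or.inl (Real.exp_pos x).ne')).continuousWithinAt
  rw [← CFC.real_exp_eq_normedSpace_exp hH, ← cfc_comp (fun x : ℝ => x ^ t) Real.exp H hH hc,
    ← CFC.real_exp_eq_normedSpace_exp ((IsSelfAdjoint.all t).smul hH), ← cfc_comp_smul t Real.exp H]
  congr 1
  ext x
  simp [← Real.exp_mul, mul_comm]

/-! ### Complex matrices with τ = Re tr; results restated for use where no matrix norm is in scope.
-/

section Matrices

open NormedSpace Matrix

variable {n : Type*} [Fintype n] [DecidableEq n]

section Norms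

open scoped Matrix.Norms.Operator

/-- The adjoint is continuous in the topology of the operator norm. -/
theorem continuousStar_normTopology :
    @ContinuousStar (Matrix n n ℂ) PseudoMetricSpace.toUniformSpace.toTopologicalSpace _ :=
  inferInstanceAs (@ContinuousStar (Matrix n n ℂ) instTopologicalSpaceMatrix _)

attribute [local instance] continuousStar_normTopology

/-- The real part of the trace. -/
noncomputable def reTrace : Matrix n n ℂ →L[ℝ] ℝ :=
  LinearMap.toContinuousLinearMap (Complex.reLm ∘ₗ traceLinearMap n ℝ ℂ)

omit [DecidableEq n] in
theorem reTrace_mul_comm (X Y : Matrix n n ℂ) : reTrace (X * Y) = reTrace (Y * X) :=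
  congrArg Complex.re (trace_mul_comm X Y)

omit [DecidableEq n] in
theorem reTrace_star_mul_self_pos (X : Matrix n n ℂ) (hX : X ≠ 0) : 0 < reTrace (star X * X) := by
  have h : 0 < (Xᴴ * X).trace :=
    lt_of_le_of_ne (posSemidef_conjTranspose_mul_self X).trace_nonneg
      fun h => hX (trace_conjTranspose_mul_self_eq_zero_iff.1 h.symm)
  exact (Complex.lt_def.1 h).1

theorem matrix_exp_smul_mul_exp_smul (H : Matrix n n ℂ) (s t : ℝ) :
    exp (s • H) * exp (t • H) = exp ((s + t) • H) :=
  exp_smul_mul_exp_smul H s t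

theorem matrix_exp_add_smul_one (H : Matrix n n ℂ) (t : ℝ) :
    exp (H + t • (1 : Matrix n n ℂ)) = Real.exp t • exp H :=
  exp_add_smul_one H t

theorem trace_conjTranspose_mul_exp_mul_exp_pos {H : Matrix n n ℂ} (hH : H.IsHermitian)
    {A : Matrix n n ℂ} (hA : A ≠ 0) (s t : ℝ) :
    0 < (Aᴴ * (exp (s • H) * A * exp (t • H))).trace.re :=
  tracial_star_mul_exp_mul_exp_pos (τ := reTrace) reTrace_mul_comm
    reTrace_star_mul_self_pos hH hA s t

theorem trace_mul_fderiv_exp_pos {H Y : Matrix n n ℂ} (hH : H.IsHermitian) (hY : Y.IsHermitian)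
    (hY0 : Y ≠ 0) : 0 < (Y * fderiv ℝ exp H Y).trace.re :=
  tracial_mul_fderiv_exp_pos (τ := reTrace) reTrace_mul_comm reTrace_star_mul_self_pos hH hY hY0

theorem eq_of_trace_exp_eq {Y Z : Matrix n n ℂ} (hY : Y.IsHermitian) (hZ : Z.IsHermitian)
    (h : ((Z - Y) * exp Y).trace.re = ((Z - Y) * exp Z).trace.re) : Y = Z :=
  eq_of_tracial_exp_eq (τ := reTrace) reTrace_mul_comm reTrace_star_mul_self_pos hY hZ h

theorem matrix_hasDerivAt_exp_add_smul (H Y : Matrix n n ℂ) :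
    HasDerivAt (fun t : ℝ => exp (H + t • Y)) (fderiv ℝ exp H Y) 0 := by
  have h : HasDerivAt (fun t : ℝ => exp (H + t • Y)) (fderiv ℝ exp (H + (0 : ℝ) • Y) Y) 0 :=
    hasDerivAt_exp_add_smul H Y 0
  rwa [zero_smul, add_zero] at h

theorem hasDerivAt_normalized_exp {H Y : Matrix n n ℂ} (hH : (exp H).trace.re = 1)
    (hY : (fderiv ℝ exp H Y).trace.re = 0) :
    HasDerivAt (fun t : ℝ => ((exp (H + t • Y)).trace.re)⁻¹ • exp (H + t • Y))
      (fderiv ℝ exp H Y) 0 :=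
  hasDerivAt_inv_smul_exp (reTrace (n := n)) hH hY

theorem matrix_exists_fderiv_exp_eq_mul (H : Matrix n n ℂ) (S : Submodule ℝ (Matrix n n ℂ))
    (hS : ∀ X ∈ S, H * X - X * H ∈ S) (Y : Matrix n n ℂ) (hY : Y ∈ S) :
    ∃ W ∈ S, fderiv ℝ exp H Y = W * exp H :=
  exists_fderiv_exp_eq_mul H S hS Y hY

theorem matrix_exp_conj_mem (H : Matrix n n ℂ) (S : Submodule ℝ (Matrix n n ℂ))
    (hS : ∀ X ∈ S, H * X - X * H ∈ S) (Y : Matrix n n ℂ) (hY : Y ∈ S) (t : ℝ) :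
    exp (t • H) * Y * exp ((-t) • H) ∈ S :=
  exp_conj_mem H S hS Y hY t

theorem matrix_exists_exp_curve_of_moments (R : Submodule ℝ (Matrix n n ℂ))
    (hR : ∀ X ∈ R, X.IsHermitian) {H : Matrix n n ℂ} (hH : H ∈ R) {σ : ℝ → Matrix n n ℂ}
    {σ' : Matrix n n ℂ} {s : Set ℝ} (hσ : HasDerivWithinAt σ σ' s 0) (hσ0 : σ 0 = exp H) :
    ∃ Y : ℝ → Matrix n n ℂ, ∃ y ∈ R, (∀ t, Y t ∈ R) ∧
      HasDerivWithinAt (fun t => exp (Y t)) (fderiv ℝ exp H y) s 0 ∧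
      (∀ᶠ t in 𝓝[s] 0, ∀ X ∈ R, (X * exp (Y t)).trace.re = (X * σ t).trace.re) ∧
      ∀ X ∈ R, (X * fderiv ℝ exp H y).trace.re = (X * σ').trace.re := by
  obtain ⟨Y, y, h1, h2, h3⟩ := exists_exp_curve_of_moments (𝔸 := Matrix n n ℂ) (E := R)
    (τ := reTrace) reTrace_mul_comm reTrace_star_mul_self_pos R.subtypeL Subtype.val_injective
    (fun X => hR X X.2) ⟨H, hH⟩ hσ hσ0
  exact ⟨fun t => Y t, y, y.2, fun t => (Y t).2, h1, h2.mono fun t ht X hX => ht ⟨X, hX⟩,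
    fun X hX => h3 ⟨X, hX⟩⟩

omit [DecidableEq n] in
theorem hasDerivWithinAt_linearMap_comp {F : Type*} [NormedAddCommGroup F] [NormedSpace ℝ F]
    (ℓ : Matrix n n ℂ →ₗ[ℝ] F) {σ : ℝ → Matrix n n ℂ} {σ' : Matrix n n ℂ} {s : Set ℝ} {t : ℝ}
    (h : HasDerivWithinAt σ σ' s t) : HasDerivWithinAt (fun r => ℓ (σ r)) (ℓ σ') s t :=
  (LinearMap.toContinuousLinearMap ℓ).hasFDerivAt.comp_hasDerivWithinAt t h

omit [DecidableEq n] in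
theorem matrix_hasDerivWithinAt {σ : ℝ → Matrix n n ℂ} {σ' : Matrix n n ℂ} {t : ℝ}
    (h : HasDerivAt σ σ' t) (s : Set ℝ) : HasDerivWithinAt σ σ' s t :=
  HasDerivAt.hasDerivWithinAt (F := Matrix n n ℂ) h

omit [DecidableEq n] in
theorem matrix_hasDerivWithinAt_congr {σ γ : ℝ → Matrix n n ℂ} {σ' : Matrix n n ℂ}
    (h : HasDerivWithinAt σ σ' (Set.Ici 0) 0) (hγ : ∀ᶠ t in 𝓝[≥] (0 : ℝ), γ t = σ t) :
    HasDerivWithinAt γ σ' (Set.Ici 0) 0 :=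
  HasDerivWithinAt.congr_of_eventuallyEq (F := Matrix n n ℂ) h hγ
    (hγ.self_of_nhdsWithin (Set.mem_Ici.2 le_rfl))

omit [DecidableEq n] in
theorem matrix_hasDerivWithinAt_unique {σ : ℝ → Matrix n n ℂ} {A B : Matrix n n ℂ}
    (hA : HasDerivWithinAt σ A (Set.Ici 0) 0) (hB : HasDerivWithinAt σ B (Set.Ici 0) 0) : A = B :=
  UniqueDiffWithinAt.eq_deriv (F := Matrix n n ℂ) _ (uniqueDiffWithinAt_Ici 0) hA hB

omit [DecidableEq n] in
theorem linearMap_deriv_eq_zero {F : Type*} [NormedAddCommGroup F] [NormedSpace ℝ F]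
    (ℓ : Matrix n n ℂ →ₗ[ℝ] F) {σ : ℝ → Matrix n n ℂ} {σ' : Matrix n n ℂ} {c : F}
    (h : HasDerivWithinAt σ σ' (Set.Ici 0) 0) (hc : ∀ t, 0 ≤ t → ℓ (σ t) = c) : ℓ σ' = 0 := by
  have h1 : HasDerivWithinAt (fun _ : ℝ => c) (ℓ σ') (Set.Ici 0) 0 :=
    (hasDerivWithinAt_linearMap_comp ℓ h).congr (fun t ht => (hc t ht).symm)
      (hc 0 le_rfl).symm
  exact (uniqueDiffWithinAt_Ici 0).eq_deriv _ h1 (hasDerivWithinAt_const _ _ _)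

omit [DecidableEq n] in
theorem isHermitian_deriv {σ : ℝ → Matrix n n ℂ} {σ' : Matrix n n ℂ}
    (h : HasDerivWithinAt σ σ' (Set.Ici 0) 0) (hσ : ∀ t, 0 ≤ t → (σ t).IsHermitian) :
    σ'.IsHermitian := by
  let ℓ : Matrix n n ℂ →ₗ[ℝ] Matrix n n ℂ :=
    { toFun := fun X => Xᴴ - X
      map_add' := fun X Y => by simp only [conjTranspose_add]; abel
      map_smul' := fun r X => by simp [smul_sub] }
  exact sub_eq_zero.1 (linearMap_deriv_eq_zero ℓ (c := 0) h fun t ht => sub_eq_zero.2 (hσ t ht))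

omit [DecidableEq n] in
theorem hasDerivWithinAt_add_smul (ρ X : Matrix n n ℂ) (s : Set ℝ) :
    HasDerivWithinAt (fun r : ℝ => ρ + r • X) X s 0 := by
  have : HasDerivAt (fun ε : ℝ => ρ + ε • X) X 0 :=
    (((hasDerivAt_id (0 : ℝ)).smul_const X).const_add ρ).congr_deriv (one_smul _ _)
  exact this.hasDerivWithinAt

theorem matPow_exp {H : Matrix n n ℂ} (hH : H.IsHermitian) (t : ℝ) :
    matPow (exp H) t = exp (t • H) := by
  exact @cfc_rpow_exp (Matrix n n ℂ) _ _ _ _ (IsHermitian.instContinuousFunctionalCalculus) H hH t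

end Norms

end Matrices

open NormedSpace Matrix

variable {N : ℕ} {n : Type*} [Fintype n] [DecidableEq n]

/-! ### Majorana operators and the Lie algebra of quadratic expressions. -/

section Majorana

omit [Fintype n] [DecidableEq n] in
theorem majorana_isHermitian (a : Fin N → Matrix n n ℂ) (k : Fin N × Fin 2) :
    (majorana a k).IsHermitian := by
  unfold majorana Matrix.IsHermitian
  split_ifs
  · simp [add_comm]
  · simp only [conjTranspose_smul, conjTranspose_sub, conjTranspose_conjTranspose,
      Complex.star_def, Complex.conj_I, neg_smul, ← smul_neg, neg_sub]

/-- Each case expands into four canonical anticommutators. In the mixed cases the two Kronecker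
deltas cancel; in the last one they have sign -1, which (-i)² = -1 repairs. -/
theorem majorana_anticomm {a : Fin N → Matrix n n ℂ} (ha : IsCAR a) (k l : Fin N × Fin 2) :
    majorana a k * majorana a l + majorana a l * majorana a k = if k = l then 2 else 0 := by
  obtain ⟨i, p⟩ := k
  obtain ⟨j, q⟩ := l
  have h1 := ha.anticomm_star i j
  have h2 := ha.anticomm_star j i
  have h3 := ha.anticomm i j
  have h4 : (a i)ᴴ * (a j)ᴴ + (a j)ᴴ * (a i)ᴴ = 0 := by
    have := congrArg conjTranspose (ha.anticomm j i)
    simpa using this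
  fin_cases p <;> fin_cases q
  · have e : ((a i)ᴴ + a i) * ((a j)ᴴ + a j) + ((a j)ᴴ + a j) * ((a i)ᴴ + a i) =
        ((a i)ᴴ * (a j)ᴴ + (a j)ᴴ * (a i)ᴴ) + ((a i)ᴴ * a j + a j * (a i)ᴴ) +
          ((a j)ᴴ * a i + a i * (a j)ᴴ) + (a i * a j + a j * a i) := by noncomm_ring
    rw [h1, h2, h3, h4] at e
    by_cases hij : i = j
    · simpa [majorana, hij, one_add_one_eq_two] using e
    · simpa [majorana, hij, Ne.symm hij] using e
  · have e : ((a i)ᴴ + a i) * ((a j)ᴴ - a j) + ((a j)ᴴ - a j) * ((a i)ᴴ + a i) =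
        ((a i)ᴴ * (a j)ᴴ + (a j)ᴴ * (a i)ᴴ) - ((a i)ᴴ * a j + a j * (a i)ᴴ) +
          ((a j)ᴴ * a i + a i * (a j)ᴴ) - (a i * a j + a j * a i) := by noncomm_ring
    rw [h1, h2, h3, h4] at e
    have e' : ((a i)ᴴ + a i) * ((a j)ᴴ - a j) + ((a j)ᴴ - a j) * ((a i)ᴴ + a i) = 0 := by
      rw [e]; simp [eq_comm]
    simp only [majorana]
    simp [← neg_add, ← smul_add, e']
  · have e : ((a i)ᴴ - a i) * ((a j)ᴴ + a j) + ((a j)ᴴ + a j) * ((a i)ᴴ - a i) =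
        ((a i)ᴴ * (a j)ᴴ + (a j)ᴴ * (a i)ᴴ) + ((a i)ᴴ * a j + a j * (a i)ᴴ) -
          ((a j)ᴴ * a i + a i * (a j)ᴴ) - (a i * a j + a j * a i) := by noncomm_ring
    rw [h1, h2, h3, h4] at e
    have e' : ((a i)ᴴ - a i) * ((a j)ᴴ + a j) + ((a j)ᴴ + a j) * ((a i)ᴴ - a i) = 0 := by
      rw [e]; simp [eq_comm]
    simp only [majorana]
    simp [← neg_add, ← smul_add, e']
  · have e : ((a i)ᴴ - a i) * ((a j)ᴴ - a j) + ((a j)ᴴ - a j) * ((a i)ᴴ - a i) =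
        ((a i)ᴴ * (a j)ᴴ + (a j)ᴴ * (a i)ᴴ) - ((a i)ᴴ * a j + a j * (a i)ᴴ) -
          ((a j)ᴴ * a i + a i * (a j)ᴴ) + (a i * a j + a j * a i) := by noncomm_ring
    rw [h1, h2, h3, h4] at e
    have e' : ((a i)ᴴ - a i) * ((a j)ᴴ - a j) + ((a j)ᴴ - a j) * ((a i)ᴴ - a i) =
        -(if i = j then 2 else 0) := by
      rw [e]
      by_cases hij : i = j
      · simp only [hij, if_true, ← one_add_one_eq_two]; abel
      · simp [hij, Ne.symm hij]
    simp only [majorana]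
    simp [smul_smul, ← neg_add, e']

/-- Written through anticommutators, which are scalars for Majorana operators, the quartic terms
cancel and only quadratic ones remain. -/
theorem commutator_mul_mul {A : Type*} [Ring A] {k l m p : A} {x y z w : A}
    (hx : l * m + m * l = x) (hy : k * m + m * k = y) (hz : l * p + p * l = z)
    (hw : k * p + p * k = w) :
    k * l * (m * p) - m * p * (k * l) = k * x * p - y * l * p + m * k * z - m * w * l := by
  subst hx hy hz hw
  noncomm_ring

/-- The complex span of `1` and the quadratic Majorana monomials. -/
def quadSpan (a : Fin N → Matrix n n ℂ) : Submodule ℂ (Matrix n n ℂ) :=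
  Submodule.span ℂ (insert 1 (Set.range fun p : (Fin N × Fin 2) × (Fin N × Fin 2) =>
    majorana a p.1 * majorana a p.2))

theorem one_mem_quadSpan (a : Fin N → Matrix n n ℂ) : 1 ∈ quadSpan a :=
  Submodule.subset_span (Set.mem_insert _ _)

theorem majorana_mul_mem_quadSpan (a : Fin N → Matrix n n ℂ) (k l : Fin N × Fin 2) :
    majorana a k * majorana a l ∈ quadSpan a :=
  Submodule.subset_span (Set.mem_insert_of_mem _ ⟨(k, l), rfl⟩)

theorem commutator_mem_quadSpan {a : Fin N → Matrix n n ℂ} (ha : IsCAR a) {X Y : Matrix n n ℂ}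
    (hX : X ∈ quadSpan a) (hY : Y ∈ quadSpan a) : X * Y - Y * X ∈ quadSpan a := by
  have hc (k l m p : Fin N × Fin 2) :
      majorana a k * majorana a l * (majorana a m * majorana a p) -
        majorana a m * majorana a p * (majorana a k * majorana a l) ∈ quadSpan a := by
    rw [commutator_mul_mul (majorana_anticomm ha l m) (majorana_anticomm ha k m)
      (majorana_anticomm ha l p) (majorana_anticomm ha k p)]
    have hδ (P : Prop) [Decidable P] (X : Matrix n n ℂ) (hX : X ∈ quadSpan a) :
        (if P then (2 : Matrix n n ℂ) else 0) * X ∈ quadSpan a := by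
      split_ifs
      · rw [two_mul]; exact add_mem hX hX
      · simp
    have hδ' (P : Prop) [Decidable P] (X : Matrix n n ℂ) :
        X * (if P then (2 : Matrix n n ℂ) else 0) = (if P then (2 : Matrix n n ℂ) else 0) * X := by
      split_ifs
      · rw [two_mul, mul_two]
      · simp
    refine sub_mem (add_mem (sub_mem ?_ ?_) ?_) ?_
    · rw [hδ', mul_assoc]; exact hδ _ _ (majorana_mul_mem_quadSpan a k p)
    · rw [mul_assoc]; exact hδ _ _ (majorana_mul_mem_quadSpan a l p)
    · rw [hδ']; exact hδ _ _ (majorana_mul_mem_quadSpan a m k)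
    · rw [hδ', mul_assoc]; exact hδ _ _ (majorana_mul_mem_quadSpan a m l)
  induction hX, hY using Submodule.span_induction₂ with
  | mem_mem X Y hX hY =>
    obtain rfl | ⟨⟨k, l⟩, rfl⟩ := hX
    · simp
    · obtain rfl | ⟨⟨m, p⟩, rfl⟩ := hY
      · simp
      · exact hc k l m p
  | zero_left => simp
  | zero_right => simp
  | add_left X Y Z _ _ _ h1 h2 =>
    have : (X + Y) * Z - Z * (X + Y) = (X * Z - Z * X) + (Y * Z - Z * Y) := by noncomm_ring
    rw [this]; exact add_mem h1 h2
  | add_right X Y Z _ _ _ h1 h2 =>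
    have : X * (Y + Z) - (Y + Z) * X = (X * Y - Y * X) + (X * Z - Z * X) := by noncomm_ring
    rw [this]; exact add_mem h1 h2
  | smul_left r X Y _ _ h =>
    rw [smul_mul_assoc, mul_smul_comm, ← smul_sub]; exact Submodule.smul_mem _ _ h
  | smul_right r X Y _ _ h =>
    rw [smul_mul_assoc, mul_smul_comm, ← smul_sub]; exact Submodule.smul_mem _ _ h

omit [DecidableEq n] in
theorem quadraticForm_add (a : Fin N → Matrix n n ℂ)
    (K K' : Matrix (Fin N × Fin 2) (Fin N × Fin 2) ℝ) :
    quadraticForm a (K + K') = quadraticForm a K + quadraticForm a K' := by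
  simp [quadraticForm, add_smul, Finset.sum_add_distrib]

omit [DecidableEq n] in
theorem quadraticForm_smul (a : Fin N → Matrix n n ℂ) (r : ℝ)
    (K : Matrix (Fin N × Fin 2) (Fin N × Fin 2) ℝ) :
    quadraticForm a (r • K) = r • quadraticForm a K := by
  have h (X : Matrix n n ℂ) : r • X = (r : ℂ) • X := (Complex.coe_smul r X).symm
  rw [h]
  simp only [quadraticForm, Matrix.smul_apply, smul_eq_mul, Complex.ofReal_mul, mul_smul,
    ← Finset.smul_sum]
  rw [smul_comm]

/-- The real space spanned by `1` and the Hermitian quadratic forms in the Majorana operators. -/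
def quadSpace (a : Fin N → Matrix n n ℂ) : Submodule ℝ (Matrix n n ℂ) where
  carrier := {X | ∃ (r : ℝ) (K : Matrix (Fin N × Fin 2) (Fin N × Fin 2) ℝ),
    Kᵀ = -K ∧ X = quadraticForm a K + r • (1 : Matrix n n ℂ)}
  add_mem' := by
    rintro _ _ ⟨r, K, hK, rfl⟩ ⟨r', K', hK', rfl⟩
    refine ⟨r + r', K + K', by simp [hK, hK', add_comm], ?_⟩
    rw [quadraticForm_add, add_smul]; abel
  zero_mem' := ⟨0, 0, by simp, by simp [quadraticForm]⟩
  smul_mem' := by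
    rintro t _ ⟨r, K, hK, rfl⟩
    exact ⟨t * r, t • K, by simp [hK], by rw [quadraticForm_smul, smul_add, smul_smul]⟩

theorem one_mem_quadSpace (a : Fin N → Matrix n n ℂ) : 1 ∈ quadSpace a :=
  ⟨1, 0, by simp, by simp [quadraticForm]⟩

-- The adjoint swaps the indices; the sign from the antisymmetry of `K` cancels the one from
-- conjugating -i/2.
omit [DecidableEq n] in
theorem isHermitian_quadraticForm (a : Fin N → Matrix n n ℂ)
    {K : Matrix (Fin N × Fin 2) (Fin N × Fin 2) ℝ} (hK : Kᵀ = -K) :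
    (quadraticForm a K).IsHermitian := by
  have hK' (k l) : K l k = -K k l := congrFun (congrFun hK k) l
  have hs : (∑ k, ∑ l, (K k l : ℂ) • (majorana a k * majorana a l))ᴴ =
      -∑ k, ∑ l, (K k l : ℂ) • (majorana a k * majorana a l) := by
    conv_lhs => rw [Finset.sum_comm]
    simp only [conjTranspose_sum, conjTranspose_smul, conjTranspose_mul,
      (majorana_isHermitian a _).eq, ← Finset.sum_neg_distrib, ← neg_smul]
    refine Finset.sum_congr rfl fun k _ => Finset.sum_congr rfl fun l _ => ?_
    simp [hK' k l]
  rw [Matrix.IsHermitian, quadraticForm, conjTranspose_smul, hs, smul_neg, ← neg_smul]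
  congr 1
  simp [neg_div]

theorem isHermitian_of_mem_quadSpace {a : Fin N → Matrix n n ℂ} {X : Matrix n n ℂ}
    (hX : X ∈ quadSpace a) : X.IsHermitian := by
  obtain ⟨r, K, hK, rfl⟩ := hX
  exact (isHermitian_quadraticForm a hK).add (isHermitian_one.smul (by simp [IsSelfAdjoint]))

theorem mem_quadSpan_of_mem_quadSpace {a : Fin N → Matrix n n ℂ} {X : Matrix n n ℂ}
    (hX : X ∈ quadSpace a) : X ∈ quadSpan a := by
  obtain ⟨r, K, hK, rfl⟩ := hX
  refine add_mem (Submodule.smul_mem _ _ (sum_mem fun k _ => sum_mem fun l _ =>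
    Submodule.smul_mem _ _ (majorana_mul_mem_quadSpan a k l))) ?_
  rw [← Complex.coe_smul]
  exact Submodule.smul_mem _ _ (one_mem_quadSpan a)

/-- The coefficient matrix of the commutator of two Majorana operators. -/
def commutatorCoeff (k l : Fin N × Fin 2) : Matrix (Fin N × Fin 2) (Fin N × Fin 2) ℝ :=
  Matrix.single k l 1 - Matrix.single l k 1

omit [DecidableEq n] in
theorem quadraticForm_commutatorCoeff (a : Fin N → Matrix n n ℂ) (k l : Fin N × Fin 2) :
    quadraticForm a (commutatorCoeff k l) = (-(Complex.I / 2)) •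
      (majorana a k * majorana a l - majorana a l * majorana a k) := by
  have h (p q : Fin N × Fin 2) :
      ∑ k, ∑ l, ((Matrix.single p q (1 : ℝ) k l : ℝ) : ℂ) • (majorana a k * majorana a l) =
        majorana a p * majorana a q := by
    rw [Finset.sum_eq_single p, Finset.sum_eq_single q]
    · simp
    · intro l _ hl
      simp [Ne.symm hl]
    · simp
    · intro k _ hk
      simp [Ne.symm hk]
    · simp
  simp only [quadraticForm, commutatorCoeff, Matrix.sub_apply, Complex.ofReal_sub, sub_smul,
    Finset.sum_sub_distrib, h]

theorem quadraticForm_commutatorCoeff_mem (a : Fin N → Matrix n n ℂ) (k l : Fin N × Fin 2) :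
    quadraticForm a (commutatorCoeff k l) ∈ quadSpace a :=
  ⟨0, commutatorCoeff k l, by simp [commutatorCoeff], by simp⟩

/-- Half the anticommutator plus half the commutator. It writes each product c_k c_l as a complex
combination of elements of `quadSpace`. -/
theorem majorana_mul_eq {a : Fin N → Matrix n n ℂ} (ha : IsCAR a) (k l : Fin N × Fin 2) :
    majorana a k * majorana a l =
      (if k = l then 1 else 0) + Complex.I • quadraticForm a (commutatorCoeff k l) := by
  have h := majorana_anticomm ha k l
  have h2 : (2 : ℂ) • (majorana a k * majorana a l) = (if k = l then 2 else 0) +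
      (majorana a k * majorana a l - majorana a l * majorana a k) := by
    rw [← h, two_smul]; abel
  have h3 : majorana a k * majorana a l =
      (1 / 2 : ℂ) • ((2 : ℂ) • (majorana a k * majorana a l)) := by
    rw [smul_smul]; norm_num
  rw [h3, h2, smul_add, quadraticForm_commutatorCoeff, smul_smul]
  congr 1
  · split_ifs
    · rw [← one_add_one_eq_two (R := Matrix n n ℂ), smul_add, ← add_smul]; norm_num
    · simp
  · congr 1
    rw [mul_neg, ← mul_div_assoc, Complex.I_mul_I]
    norm_num

theorem covariance_apply_eq (a : Fin N → Matrix n n ℂ) (σ : Matrix n n ℂ) (k l : Fin N × Fin 2) :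
    covariance a σ k l = -(quadraticForm a (commutatorCoeff k l) * σ).trace := by
  rw [quadraticForm_commutatorCoeff]
  simp [covariance]

-- An antisymmetric `K` sees only commutators, so the covariance matrix determines all moments of
-- quadratic forms.
omit [DecidableEq n] in
theorem trace_quadraticForm_mul (a : Fin N → Matrix n n ℂ)
    {K : Matrix (Fin N × Fin 2) (Fin N × Fin 2) ℝ} (hK : Kᵀ = -K) (σ : Matrix n n ℂ) :
    (quadraticForm a K * σ).trace = -(1 / 2) * ∑ k, ∑ l, (K k l : ℂ) * covariance a σ k l := by
  have hK' (k l) : (K l k : ℂ) = -K k l := by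
    exact_mod_cast congrFun (congrFun hK k) l
  let t k l := (majorana a k * majorana a l * σ).trace
  have hcov (k l) : covariance a σ k l = Complex.I / 2 * (t k l - t l k) := by
    simp [covariance, t, sub_mul]
  have hswap : ∑ k, ∑ l, (K k l : ℂ) * t l k = -∑ k, ∑ l, (K k l : ℂ) * t k l := by
    rw [Finset.sum_comm, ← Finset.sum_neg_distrib]
    refine Finset.sum_congr rfl fun k _ => ?_
    rw [← Finset.sum_neg_distrib]
    exact Finset.sum_congr rfl fun l _ => by rw [hK' k l, neg_mul]
  have hl : (quadraticForm a K * σ).trace = -(Complex.I / 2) * ∑ k, ∑ l, (K k l : ℂ) * t k l := by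
    simp only [quadraticForm, smul_mul_assoc, Finset.sum_mul, trace_smul, trace_sum, smul_eq_mul, t]
  have hr : ∑ k, ∑ l, (K k l : ℂ) * covariance a σ k l =
      Complex.I / 2 * (∑ k, ∑ l, (K k l : ℂ) * t k l - ∑ k, ∑ l, (K k l : ℂ) * t l k) := by
    simp only [← Finset.sum_sub_distrib, Finset.mul_sum]
    exact Finset.sum_congr rfl fun k _ => Finset.sum_congr rfl fun l _ => by rw [hcov]; ring
  rw [hl, hr, hswap]
  ring

/-- The trace of a product of two Hermitian matrices is real, so real parts suffice on `quadSpace`;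
complex linearity then reaches `quadSpan`. -/
theorem trace_mul_eq_zero_of_mem_quadSpan {a : Fin N → Matrix n n ℂ} (ha : IsCAR a)
    {D : Matrix n n ℂ} (hD : D.IsHermitian) (h : ∀ X ∈ quadSpace a, (X * D).trace.re = 0)
    {X : Matrix n n ℂ} (hX : X ∈ quadSpan a) : (X * D).trace = 0 := by
  have h' (X) (hX : X ∈ quadSpace a) : (X * D).trace = 0 := by
    refine Complex.ext (h X hX) ?_
    have hc : star (X * D).trace = (X * D).trace := by
      rw [← trace_conjTranspose, conjTranspose_mul, hD.eq, (isHermitian_of_mem_quadSpace hX).eq,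
        trace_mul_comm]
    exact Complex.conj_eq_iff_im.1 hc
  induction hX using Submodule.span_induction with
  | mem X hX =>
    obtain rfl | ⟨⟨k, l⟩, rfl⟩ := hX
    · exact h' 1 (one_mem_quadSpace a)
    · simp only [majorana_mul_eq ha k l, add_mul, trace_add, smul_mul_assoc, trace_smul,
        h' _ (quadraticForm_commutatorCoeff_mem a k l), smul_zero, add_zero]
      split_ifs
      · exact h' 1 (one_mem_quadSpace a)
      · simp
  | zero => simp
  | add X Y _ _ hX hY => rw [add_mul, trace_add, hX, hY, add_zero]
  | smul r X _ hX => rw [smul_mul_assoc, trace_smul, hX, smul_zero]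

end Majorana

/-! ### Gaussian states, Gaussifications and small perturbations of states. -/

section States

theorem posSemidef_exp {H : Matrix n n ℂ} (hH : H.IsHermitian) : (exp H).PosSemidef := by
  have h2 : ((1 / 2 : ℝ) • H).IsHermitian := hH.smul (by simp [IsSelfAdjoint])
  have h := posSemidef_conjTranspose_mul_self (exp ((1 / 2 : ℝ) • H))
  rw [h2.exp.eq, matrix_exp_smul_mul_exp_smul] at h
  norm_num at h
  exact h

/-- A Gaussian state is the exponential of a quadratic expression. -/
theorem mem_gaussianStates_iff {a : Fin N → Matrix n n ℂ} {ρ : Matrix n n ℂ} :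
    ρ ∈ gaussianStates a ↔ ∃ Y ∈ quadSpace a, ρ = exp Y ∧ ρ.trace.re = 1 := by
  constructor
  · rintro ⟨hs, κ, K, hK, rfl⟩
    have htr := hs.2
    have hpos := (posSemidef_exp (isHermitian_quadraticForm a hK)).trace_nonneg
    rw [trace_smul, smul_eq_mul] at htr
    -- Positivity of κ comes from the normalisation, and it allows κ to enter the exponent as log κ.
    have hκ : 0 < κ := by
      by_contra hκ
      have h1 : κ * (exp (quadraticForm a K)).trace.re = 1 := by
        have := congrArg Complex.re htr
        simpa using this
      have h2 : 0 ≤ (exp (quadraticForm a K)).trace.re := (Complex.le_def.1 hpos).1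
      nlinarith
    refine ⟨quadraticForm a K + Real.log κ • 1, ⟨_, K, hK, rfl⟩, ?_, by rw [hs.2]; rfl⟩
    rw [matrix_exp_add_smul_one, Real.exp_log hκ, Complex.coe_smul]
  · rintro ⟨_, ⟨r, K, hK, rfl⟩, rfl, htr⟩
    have hps := posSemidef_exp (isHermitian_of_mem_quadSpace (a := a) ⟨r, K, hK, rfl⟩)
    refine ⟨⟨hps, ?_⟩, Real.exp r, K, hK, by rw [matrix_exp_add_smul_one, Complex.coe_smul]⟩
    exact Complex.ext htr (Complex.le_def.1 hps.trace_nonneg).2.symm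

/-- Reduces Gaussification to a moment problem on `quadSpace`; the element 1 encodes the
normalisation. -/
theorem isGaussification_iff {a : Fin N → Matrix n n ℂ} (ha : IsCAR a) {σ τ : Matrix n n ℂ} :
    IsGaussification a σ τ ↔ IsState σ ∧ ∃ Y ∈ quadSpace a, τ = exp Y ∧
      ∀ X ∈ quadSpace a, (X * τ).trace.re = (X * σ).trace.re := by
  constructor
  · rintro ⟨hσ, hτ, hcov⟩
    obtain ⟨Y, hY, rfl, htr⟩ := mem_gaussianStates_iff.1 hτ
    refine ⟨hσ, Y, hY, rfl, ?_⟩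
    rintro _ ⟨r, K, hK, rfl⟩
    rw [add_mul, add_mul, trace_add, trace_add, trace_quadraticForm_mul a hK,
      trace_quadraticForm_mul a hK, hcov, smul_mul_assoc, smul_mul_assoc, one_mul, one_mul,
      trace_smul, trace_smul, hσ.2, hτ.1.2]
  · rintro ⟨hσ, Y, hY, rfl, h⟩
    have htr : (exp Y).trace.re = 1 := by
      have := h 1 (one_mem_quadSpace a)
      rw [one_mul, one_mul, hσ.2] at this
      exact this
    refine ⟨hσ, mem_gaussianStates_iff.2 ⟨Y, hY, rfl, htr⟩, ?_⟩
    ext k l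
    have hD : (exp Y - σ).IsHermitian :=
      (posSemidef_exp (isHermitian_of_mem_quadSpace hY)).1.sub hσ.1.1
    have h0 := trace_mul_eq_zero_of_mem_quadSpan ha hD
      (fun X hX => by rw [mul_sub, trace_sub, Complex.sub_re, h X hX, sub_self])
      (mem_quadSpan_of_mem_quadSpace (quadraticForm_commutatorCoeff_mem a k l))
    rw [mul_sub, trace_sub, sub_eq_zero] at h0
    rw [covariance_apply_eq, covariance_apply_eq, h0]

/-- Two exponentials of quadratic expressions with the same quadratic moments agree. -/
theorem exp_eq_of_moments_eq {a : Fin N → Matrix n n ℂ} {Y Z : Matrix n n ℂ}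
    (hY : Y ∈ quadSpace a) (hZ : Z ∈ quadSpace a)
    (h : ∀ X ∈ quadSpace a, (X * exp Y).trace.re = (X * exp Z).trace.re) : exp Y = exp Z := by
  rw [eq_of_trace_exp_eq (isHermitian_of_mem_quadSpace hY) (isHermitian_of_mem_quadSpace hZ)
    (h _ (sub_mem hZ hY))]

omit [DecidableEq n] in
theorem IsCPT.isState {Φ : Matrix n n ℂ →ₗ[ℂ] Matrix n n ℂ} (hΦ : IsCPT Φ) {ρ : Matrix n n ℂ}
    (hρ : IsState ρ) : IsState (Φ ρ) := by
  refine ⟨?_, by rw [hΦ.2, hρ.2]⟩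
  -- Positivity is complete positivity with m = 1, identifying `Fin 1 × n` with `n`.
  have h := (hΦ.1 1 (ρ.submatrix Prod.snd Prod.snd) (hρ.1.submatrix _)).submatrix
    (fun i : n => ((0 : Fin 1), i))
  exact h

theorem eventually_posSemidef_one_add_smul {Z : Matrix n n ℂ} (hZ : Z.IsHermitian) :
    ∀ᶠ s in 𝓝 (0 : ℝ), (1 + s • Z).PosSemidef := by
  have hev : ∀ᶠ s in 𝓝 (0 : ℝ), ∀ i, 0 < 1 + s * hZ.eigenvalues i := by
    refine Filter.eventually_all.2 fun i => ?_
    have hc : ContinuousAt (fun s : ℝ => 1 + s * hZ.eigenvalues i) 0 := by fun_prop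
    exact hc.eventually (lt_mem_nhds (by simp))
  filter_upwards [hev] with s hs
  let U : Matrix n n ℂ := (hZ.eigenvectorUnitary : Matrix n n ℂ)
  have hUU : U * Uᴴ = 1 := Unitary.mul_star_self_of_mem hZ.eigenvectorUnitary.2
  have hdiag : (diagonal fun i => ((1 + s * hZ.eigenvalues i : ℝ) : ℂ)).PosSemidef :=
    PosSemidef.diagonal fun i => by
      simpa using Complex.zero_le_real.2 (hs i).le
  have h := hdiag.mul_mul_conjTranspose_same U
  have hspec : Z = U * diagonal (fun i => (hZ.eigenvalues i : ℂ)) * Uᴴ := by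
    conv_lhs => rw [hZ.spectral_theorem]
    rfl
  convert h using 1
  have hd : (diagonal fun i => ((1 + s * hZ.eigenvalues i : ℝ) : ℂ)) =
      1 + s • diagonal (fun i => (hZ.eigenvalues i : ℂ)) := by
    ext i j
    by_cases hij : i = j
    · subst hij; simp
    · simp [hij]
  rw [hd, mul_add, add_mul, mul_one, hUU, mul_smul_comm, smul_mul_assoc, ← hspec]

/-- Full rank allows the factorisation e^H + sX = e^{H/2} (1 + s e^{-H/2} X e^{-H/2}) e^{H/2}, whose
middle factor is positive for small s. -/
theorem eventually_isState_add_smul {H X : Matrix n n ℂ} (hH : H.IsHermitian)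
    (htr : (exp H).trace = 1) (hX : X.IsHermitian) (hX0 : X.trace = 0) :
    ∀ᶠ s in 𝓝 (0 : ℝ), IsState (exp H + s • X) := by
  have hh (t : ℝ) : (exp (t • H)).IsHermitian :=
    IsHermitian.exp (hH.smul (by simp [IsSelfAdjoint]))
  have hZ : (exp ((-(1 / 2) : ℝ) • H) * X * exp ((-(1 / 2) : ℝ) • H)).IsHermitian := by
    have := isHermitian_conjTranspose_mul_mul (exp ((-(1 / 2) : ℝ) • H)) hX
    rwa [(hh _).eq] at this
  filter_upwards [eventually_posSemidef_one_add_smul hZ] with s hs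
  refine ⟨?_, by rw [trace_add, trace_smul, htr, hX0, smul_zero, add_zero]⟩
  have h := hs.mul_mul_conjTranspose_same (exp ((1 / 2 : ℝ) • H))
  have e1 : exp ((1 / 2 : ℝ) • H) * exp ((1 / 2 : ℝ) • H) = exp H := by
    rw [matrix_exp_smul_mul_exp_smul]; norm_num
  have e2 : exp ((1 / 2 : ℝ) • H) * exp ((-(1 / 2) : ℝ) • H) = 1 := by
    rw [matrix_exp_smul_mul_exp_smul]; simp
  have e3 : exp ((-(1 / 2) : ℝ) • H) * exp ((1 / 2 : ℝ) • H) = 1 := by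
    rw [matrix_exp_smul_mul_exp_smul]; simp
  convert h using 1
  rw [(hh _).eq, mul_add, mul_one, add_mul, e1, mul_smul_comm, smul_mul_assoc]
  congr 2
  calc X = 1 * X * 1 := by simp
    _ = (exp ((1 / 2 : ℝ) • H) * exp ((-(1 / 2) : ℝ) • H)) * X *
        (exp ((-(1 / 2) : ℝ) • H) * exp ((1 / 2 : ℝ) • H)) := by rw [e2, e3]
    _ = _ := by simp only [mul_assoc]

end States

/-! ### The tangent space and velocities of Gaussified curves. -/

section TangentSpace

variable {a : Fin N → Matrix n n ℂ} {H : Matrix n n ℂ}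

theorem trace_exp_pos [Nonempty n] {Y : Matrix n n ℂ} (hY : Y.IsHermitian) :
    0 < (exp Y).trace.re := by
  simpa using trace_conjTranspose_mul_exp_mul_exp_pos hY one_ne_zero 1 0

omit [DecidableEq n] in
theorem nonempty_of_trace_re_eq_one {X : Matrix n n ℂ} (hX : X.trace.re = 1) : Nonempty n := by
  by_contra h
  rw [not_nonempty_iff] at h
  simp [Matrix.trace] at hX

theorem isHermitian_fderiv_exp (hH : H.IsHermitian) {Y : Matrix n n ℂ} (hY : Y.IsHermitian) :
    (fderiv ℝ exp H Y).IsHermitian :=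
  isHermitian_deriv (matrix_hasDerivWithinAt (matrix_hasDerivAt_exp_add_smul H Y) _)
    fun t _ => (hH.add (hY.smul (IsSelfAdjoint.all t))).exp

/-- The tangent space of the Gaussian states at `e^H` consists of the traceless derivatives of
the exponential along quadratic expressions. -/
theorem mem_tangentSpace_iff (hH : H ∈ quadSpace a) (htr : (exp H).trace.re = 1)
    {B : Matrix n n ℂ} : B ∈ tangentSpace (gaussianStates a) (exp H) ↔
      ∃ y ∈ quadSpace a, fderiv ℝ exp H y = B ∧ B.trace.re = 0 := by
  constructor
  · intro hB
    let W : Submodule ℝ (Matrix n n ℂ) :=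
      (quadSpace a).map (fderiv ℝ exp H).toLinearMap ⊓
        LinearMap.ker (Complex.reLm ∘ₗ traceLinearMap n ℝ ℂ)
    have hle : tangentSpace (gaussianStates a) (exp H) ≤ W := by
      refine Submodule.span_le.2 ?_
      rintro A ⟨γ, hγ, hγ0, hA⟩
      have hA' : HasDerivWithinAt γ A (Set.Ici 0) 0 :=
        matrix_hasDerivWithinAt hA _
      obtain ⟨Y, y, hy, hY, hd, hev, -⟩ := matrix_exists_exp_curve_of_moments (quadSpace a)
        (fun X hX => isHermitian_of_mem_quadSpace hX) hH hA' hγ0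
      -- No regularity of the exponents of γ is assumed: the lifted curve has the same moments,
      -- hence equals γ.
      have heq : ∀ᶠ t in 𝓝[≥] (0 : ℝ), γ t = exp (Y t) := by
        filter_upwards [hev] with t ht
        obtain ⟨Z, hZ, hγZ, -⟩ := mem_gaussianStates_iff.1 (hγ t)
        rw [hγZ]
        exact exp_eq_of_moments_eq hZ (hY t) fun X hX => by rw [ht X hX, hγZ]
      have hd' : HasDerivWithinAt γ (fderiv ℝ exp H y) (Set.Ici 0) 0 :=
        matrix_hasDerivWithinAt_congr hd heq
      have hAy : A = fderiv ℝ exp H y := matrix_hasDerivWithinAt_unique hA' hd'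
      refine ⟨⟨y, hy, hAy.symm⟩, ?_⟩
      refine linearMap_deriv_eq_zero (Complex.reLm ∘ₗ traceLinearMap n ℝ ℂ) (c := 1) hA'
        fun t _ => ?_
      exact congrArg Complex.re (hγ t).1.2
    obtain ⟨⟨y, hy, hyB⟩, hB0⟩ := hle hB
    exact ⟨y, hy, hyB, hB0⟩
  · rintro ⟨y, hy, rfl, h0⟩
    have := nonempty_of_trace_re_eq_one htr
    refine Submodule.subset_span ⟨_, fun t => ?_, ?_, hasDerivAt_normalized_exp htr h0⟩
    · have hm : H + t • y ∈ quadSpace a := add_mem hH (Submodule.smul_mem _ _ hy)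
      have hpos := trace_exp_pos (isHermitian_of_mem_quadSpace hm)
      -- The multiple of 1 in the exponent realises the normalisation.
      refine mem_gaussianStates_iff.2 ⟨H + t • y + Real.log ((exp (H + t • y)).trace.re)⁻¹ • 1,
        add_mem hm (Submodule.smul_mem _ _ (one_mem_quadSpace a)), ?_, ?_⟩
      · rw [matrix_exp_add_smul_one, Real.exp_log (inv_pos.2 hpos)]
      · rw [trace_smul, Complex.smul_re, smul_eq_mul, inv_mul_cancel₀ hpos.ne']
    · simp [htr]

theorem isHermitian_of_mem_tangentSpace (hH : H ∈ quadSpace a) (htr : (exp H).trace.re = 1)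
    {B : Matrix n n ℂ} (hB : B ∈ tangentSpace (gaussianStates a) (exp H)) : B.IsHermitian := by
  obtain ⟨y, hy, rfl, -⟩ := (mem_tangentSpace_iff hH htr).1 hB
  exact isHermitian_fderiv_exp (isHermitian_of_mem_quadSpace hH) (isHermitian_of_mem_quadSpace hy)

theorem trace_eq_zero_of_mem_tangentSpace (hH : H ∈ quadSpace a) (htr : (exp H).trace.re = 1)
    {B : Matrix n n ℂ} (hB : B ∈ tangentSpace (gaussianStates a) (exp H)) : B.trace = 0 := by
  obtain ⟨y, hy, -, h0⟩ := (mem_tangentSpace_iff hH htr).1 hB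
  refine Complex.ext h0 ?_
  have hc : star B.trace = B.trace := by
    rw [← trace_conjTranspose, (isHermitian_of_mem_tangentSpace hH htr hB).eq]
  exact Complex.conj_eq_iff_im.1 hc

/-- A tangent vector is determined by its quadratic moments. -/
theorem eq_of_moments_eq_of_mem_tangentSpace (hH : H ∈ quadSpace a)
    (htr : (exp H).trace.re = 1) {A B : Matrix n n ℂ}
    (hA : A ∈ tangentSpace (gaussianStates a) (exp H))
    (hB : B ∈ tangentSpace (gaussianStates a) (exp H))
    (h : ∀ X ∈ quadSpace a, (X * A).trace.re = (X * B).trace.re) : A = B := by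
  rw [← sub_eq_zero]
  obtain ⟨y, hy, hyD, -⟩ := (mem_tangentSpace_iff hH htr).1 (sub_mem hA hB)
  -- The difference is d exp_H(y); testing it against y itself contradicts positivity unless y = 0.
  have hy0 : y = 0 := by
    by_contra hne
    have hpos := trace_mul_fderiv_exp_pos (isHermitian_of_mem_quadSpace hH)
      (isHermitian_of_mem_quadSpace hy) hne
    rw [hyD, mul_sub, trace_sub, Complex.sub_re, h y hy, sub_self] at hpos
    exact lt_irrefl _ hpos
  rw [← hyD, hy0, map_zero]

/-- The trace hypothesis covers the generator 1, also when N = 0 and there are no products c_k c_l.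
-/
theorem trace_mul_eq_zero_of_majorana {D : Matrix n n ℂ} (hD : D.trace = 0)
    (h : ∀ k l, (majorana a k * majorana a l * D).trace = 0) {X : Matrix n n ℂ}
    (hX : X ∈ quadSpan a) : (X * D).trace = 0 := by
  induction hX using Submodule.span_induction with
  | mem X hX =>
    obtain rfl | ⟨⟨k, l⟩, rfl⟩ := hX
    · rw [one_mul, hD]
    · exact h k l
  | zero => simp
  | add X Y _ _ hX hY => rw [add_mul, trace_add, hX, hY, add_zero]
  | smul r X _ hX => rw [smul_mul_assoc, trace_smul, hX, smul_zero]

/-- Only the initial velocity of σ matters, so the evolution and its linear step share the same `A`.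
-/
theorem isGaussifiedVelocity_of_moments (ha : IsCAR a) (hH : H ∈ quadSpace a)
    (htr : (exp H).trace.re = 1) {A X : Matrix n n ℂ}
    (hA : A ∈ tangentSpace (gaussianStates a) (exp H)) (hX : X.trace.re = 0)
    (hAX : ∀ Z ∈ quadSpace a, (Z * A).trace.re = (Z * X).trace.re) {σ : ℝ → Matrix n n ℂ}
    (hσ : HasDerivWithinAt σ X (Set.Ici 0) 0) (hσ0 : σ 0 = exp H)
    (hs : ∀ᶠ s in 𝓝[≥] (0 : ℝ), IsState (σ s)) : IsGaussifiedVelocity a σ A := by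
  obtain ⟨Y, y, hy, hY, hd, hev, hmom⟩ := matrix_exists_exp_curve_of_moments (quadSpace a)
    (fun X hX => isHermitian_of_mem_quadSpace hX) hH hσ hσ0
  have hyA : fderiv ℝ exp H y = A := by
    refine eq_of_moments_eq_of_mem_tangentSpace hH htr
      ((mem_tangentSpace_iff hH htr).2 ⟨y, hy, rfl, ?_⟩) hA
      fun Z hZ => by rw [hmom Z hZ, hAX Z hZ]
    have := hmom 1 (one_mem_quadSpace a)
    rwa [one_mul, one_mul, hX] at this
  have huniq (t : ℝ) (ht : ∀ X ∈ quadSpace a, (X * exp (Y t)).trace.re = (X * σ t).trace.re)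
      (τ : Matrix n n ℂ) (hτ : IsGaussification a (σ t) τ) : τ = exp (Y t) := by
    obtain ⟨-, Z, hZ, rfl, hmZ⟩ := (isGaussification_iff ha).1 hτ
    exact exp_eq_of_moments_eq hZ (hY t) fun X hX => by rw [hmZ X hX, ht X hX]
  refine ⟨?_, fun γ hγ => ?_⟩
  · filter_upwards [hs, hev] with t hst ht
    exact ⟨exp (Y t), (isGaussification_iff ha).2 ⟨hst, Y t, hY t, rfl, ht⟩, huniq t ht⟩
  · have heq : ∀ᶠ t in 𝓝[≥] (0 : ℝ), γ t = exp (Y t) := by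
      filter_upwards [hγ, hev] with t hγt ht using huniq t ht _ hγt
    rw [← hyA]
    exact matrix_hasDerivWithinAt_congr hd heq

/-- Lift the moments of the straight line e^H + sX, which need not consist of states; testing
against 1 gives tracelessness. -/
theorem exists_mem_tangentSpace_moments (hH : H ∈ quadSpace a) (htr : (exp H).trace.re = 1)
    {X : Matrix n n ℂ} (hX : X.trace.re = 0) :
    ∃ A ∈ tangentSpace (gaussianStates a) (exp H),
      ∀ Z ∈ quadSpace a, (Z * A).trace.re = (Z * X).trace.re := by
  obtain ⟨Y, y, hy, -, -, -, hmom⟩ := matrix_exists_exp_curve_of_moments (quadSpace a)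
    (fun X hX => isHermitian_of_mem_quadSpace hX) hH
    (hasDerivWithinAt_add_smul (exp H) X (Set.Ici 0)) (by simp)
  refine ⟨_, (mem_tangentSpace_iff hH htr).2 ⟨y, hy, rfl, ?_⟩, hmom⟩
  have := hmom 1 (one_mem_quadSpace a)
  rwa [one_mul, one_mul, hX] at this

end TangentSpace

/-! ### The metrics and the orthogonal projection. -/

section Metrics

variable {a : Fin N → Matrix n n ℂ} {H : Matrix n n ℂ}

/-- Superoperators that are symmetric and positive definite for the Hilbert-Schmidt inner product
and map `T` into `S`. -/
structure IsMetricInto (T : Submodule ℝ (Matrix n n ℂ)) (S : Submodule ℂ (Matrix n n ℂ))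
    (Ω : Matrix n n ℂ →ₗ[ℂ] Matrix n n ℂ) : Prop where
  symm : ∀ A B, (Aᴴ * Ω B).trace = ((Ω A)ᴴ * B).trace
  pos : ∀ A, A ≠ 0 → 0 < sqLength Ω A
  map_mem : ∀ B ∈ T, Ω B ∈ S

/-- Reduces all convex combinations to the individual Ω^α. -/
theorem convex_isMetricInto (T : Submodule ℝ (Matrix n n ℂ))
    (S : Submodule ℂ (Matrix n n ℂ)) : Convex ℝ {Ω | IsMetricInto T S Ω} := by
  rintro Ω hΩ Ω' hΩ' r s hr hs hrs
  refine ⟨fun A B => ?_, fun A hA => ?_, fun B hB => ?_⟩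
  · simp [mul_add, add_mul, hΩ.symm, hΩ'.symm]
  · have h1 := hΩ.pos A hA
    have h2 := hΩ'.pos A hA
    have he : sqLength (r • Ω + s • Ω') A = r * sqLength Ω A + s * sqLength Ω' A := by
      simp [sqLength, mul_add]
    rw [he]
    rcases hr.eq_or_lt with rfl | hr
    · have : s = 1 := by linarith
      subst this
      simpa using h2
    · have := mul_pos hr h1
      have := mul_nonneg hs h2.le
      linarith
  · have h1 := S.smul_mem (r : ℂ) (hΩ.map_mem B hB)
    have h2 := S.smul_mem (s : ℂ) (hΩ'.map_mem B hB)
    rw [Complex.coe_smul] at h1 h2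
    exact add_mem h1 h2

theorem alphaMetric_exp_apply (hH : H.IsHermitian) (α : ℝ) (B : Matrix n n ℂ) :
    alphaMetric (exp H) α B = (1 / 2 : ℂ) • (exp ((-α) • H) * B * exp ((α - 1) • H) +
      exp ((α - 1) • H) * B * exp ((-α) • H)) := by
  simp only [alphaMetric, matPow_exp hH, LinearMap.smul_apply, LinearMap.add_apply,
    LinearMap.mulLeftRight_apply]

/-- The heart of the independence of α: a tangent vector is W e^H with W in `quadSpan`, and the
factor e^H turns both terms of Ω^α into conjugates of W by exponentials of H. -/
theorem isMetricInto_alphaMetric (ha : IsCAR a) (hH : H ∈ quadSpace a)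
    (htr : (exp H).trace.re = 1) (α : ℝ) :
    IsMetricInto (tangentSpace (gaussianStates a) (exp H)) (quadSpan a)
      (alphaMetric (exp H) α) := by
  have hHh := isHermitian_of_mem_quadSpace hH
  have hh (t : ℝ) : (exp (t • H))ᴴ = exp (t • H) :=
    (hHh.smul (by simp [IsSelfAdjoint])).exp
  refine ⟨fun A B => ?_, fun A hA => ?_, fun B hB => ?_⟩
  · have key (P Q : Matrix n n ℂ) : (Aᴴ * (P * B * Q)).trace = (Q * Aᴴ * P * B).trace := by
      rw [← mul_assoc, trace_mul_comm]; simp only [mul_assoc]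
    simp only [alphaMetric_exp_apply hHh, mul_smul_comm, mul_add, trace_smul, trace_add, key,
      conjTranspose_smul, conjTranspose_add, conjTranspose_mul, hh, smul_mul_assoc, add_mul]
    simp [mul_assoc]
  · have h1 := trace_conjTranspose_mul_exp_mul_exp_pos hHh hA (-α) (α - 1)
    have h2 := trace_conjTranspose_mul_exp_mul_exp_pos hHh hA (α - 1) (-α)
    have he : sqLength (alphaMetric (exp H) α) A =
        (1 / 2) * ((Aᴴ * (exp ((-α) • H) * A * exp ((α - 1) • H))).trace.re +
          (Aᴴ * (exp ((α - 1) • H) * A * exp ((-α) • H))).trace.re) := by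
      rw [sqLength, alphaMetric_exp_apply hHh, mul_smul_comm, trace_smul, mul_add, trace_add,
        smul_eq_mul, show (1 / 2 : ℂ) = ((1 / 2 : ℝ) : ℂ) by norm_num, Complex.re_ofReal_mul,
        Complex.add_re]
    rw [he]
    linarith
  · obtain ⟨y, hy, rfl, -⟩ := (mem_tangentSpace_iff hH htr).1 hB
    have hS : ∀ X ∈ (quadSpan a).restrictScalars ℝ,
        H * X - X * H ∈ (quadSpan a).restrictScalars ℝ := fun X hX =>
      commutator_mem_quadSpan ha (mem_quadSpan_of_mem_quadSpace hH) hX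
    obtain ⟨W, hW, hWy⟩ := matrix_exists_fderiv_exp_eq_mul H
      ((quadSpan a).restrictScalars ℝ) hS y (mem_quadSpan_of_mem_quadSpace hy)
    have key (s t : ℝ) (hst : 1 + t = -s) :
        exp (s • H) * (W * exp H) * exp (t • H) ∈ quadSpan a := by
      have h := matrix_exp_conj_mem H _ hS W hW s
      have e : exp H * exp (t • H) = exp ((-s) • H) := by
        have := matrix_exp_smul_mul_exp_smul H 1 t
        rwa [one_smul, hst] at this
      rw [← mul_assoc, mul_assoc _ (exp H), e]
      exact h
    rw [alphaMetric_exp_apply hHh, hWy]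
    exact Submodule.smul_mem _ _ (add_mem (key _ _ (by ring)) (key _ _ (by ring)))

theorem isMetricInto_of_mem_alphaMetrics (ha : IsCAR a) (hH : H ∈ quadSpace a)
    (htr : (exp H).trace.re = 1) {Ω : Matrix n n ℂ →ₗ[ℂ] Matrix n n ℂ}
    (hΩ : Ω ∈ alphaMetrics (exp H)) :
    IsMetricInto (tangentSpace (gaussianStates a) (exp H)) (quadSpan a) Ω := by
  refine convexHull_min ?_ (convex_isMetricInto _ _) hΩ
  rintro _ ⟨α, rfl⟩
  exact isMetricInto_alphaMetric ha hH htr α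

/-- If `A - X` is orthogonal to `S`, then `A` is the unique projection of `X` onto `T`. -/
theorem IsMetricInto.isTDVPProjection_iff {T : Submodule ℝ (Matrix n n ℂ)}
    {S : Submodule ℂ (Matrix n n ℂ)} {Ω : Matrix n n ℂ →ₗ[ℂ] Matrix n n ℂ}
    (hΩ : IsMetricInto T S Ω) {X A : Matrix n n ℂ} (hA : A ∈ T)
    (hD : (A - X).IsHermitian) (h : ∀ Z ∈ S, (Z * (A - X)).trace = 0) (B : Matrix n n ℂ) :
    IsTDVPProjection Ω T X B ↔ B = A := by
  have hcross (C) (hC : C ∈ T) : ((A - X)ᴴ * Ω C).trace = 0 := by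
    rw [hD.eq, trace_mul_comm, h _ (hΩ.map_mem C hC)]
  have hcross' (C) (hC : C ∈ T) : (Cᴴ * Ω (A - X)).trace = 0 := by
    rw [hΩ.symm, ← star_eq_zero, ← trace_conjTranspose, conjTranspose_mul,
      conjTranspose_conjTranspose, hcross C hC]
  -- Pythagoras: the cross terms vanish because Ω maps `T` into `S`.
  have hpyth (B) (hB : B ∈ T) : sqLength Ω (B - X) = sqLength Ω (B - A) + sqLength Ω (A - X) := by
    have hC := sub_mem hB hA
    rw [← sub_add_sub_cancel B A X]
    simp only [sqLength]
    rw [map_add, conjTranspose_add, add_mul, mul_add, mul_add, trace_add, trace_add, trace_add,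
      hcross _ hC, hcross' _ hC]
    simp
  have h0 : sqLength Ω 0 = 0 := by simp [sqLength]
  constructor
  · rintro ⟨hB, hmin⟩
    by_contra hne
    have h1 := hmin A hA
    have h2 := hΩ.pos (B - A) (sub_ne_zero.2 hne)
    rw [hpyth B hB] at h1
    linarith
  · rintro rfl
    refine ⟨hA, fun C hC => ?_⟩
    rw [hpyth C hC]
    rcases eq_or_ne (C - B) 0 with he | he
    · rw [he, h0, zero_add]
    · linarith [hΩ.pos _ he]

end Metrics

end FermionTDVP

/-! ### The main theorem. -/

open FermionTDVP in
theorem theorem1 {N : ℕ} {n : Type*} [Fintype n] [DecidableEq n]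
    (a : Fin N → Matrix n n ℂ) (ha : IsCAR a)
    (E : ℝ → (Matrix n n ℂ →ₗ[ℂ] Matrix n n ℂ)) (L : Matrix n n ℂ →ₗ[ℂ] Matrix n n ℂ)
    (hE : IsMarkovianEvolution E L)
    (ρ : Matrix n n ℂ) (hρ : ρ ∈ gaussianStates a) :
    ∃ A ∈ tangentSpace (gaussianStates a) ρ,
      -- for every metric, `A` is the one and only TDVP projection of `L ρ`
      (∀ Ω ∈ alphaMetrics ρ, ∀ B : Matrix n n ℂ,
        IsTDVPProjection Ω (tangentSpace (gaussianStates a) ρ) (L ρ) B ↔ B = A) ∧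
      -- in every basis of the tangent space, the coordinates of `A` are the unique solution of
      -- the Gaussification equations
      (∀ (D : ℕ) (b : Module.Basis (Fin D) ℝ (tangentSpace (gaussianStates a) ρ)),
        ∃ v : Fin D → ℝ, A = ∑ j, v j • (b j : Matrix n n ℂ) ∧
          ∀ w : Fin D → ℝ,
            (∀ k₁ k₂ : Fin N × Fin 2,
              (majorana a k₁ * majorana a k₂ * L ρ).trace =
                ∑ j, (w j : ℂ) *
                  (majorana a k₁ * majorana a k₂ * (b j : Matrix n n ℂ)).trace) ↔ w = v) ∧
      -- `A` is the velocity of the Gaussified evolution, and of the Gaussified linear step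
      IsGaussifiedVelocity a (fun s => E s ρ) A ∧
      IsGaussifiedVelocity a (fun s => ρ + s • L ρ) A := by
  have hρs : IsState ρ := hρ.1
  have hstate (t : ℝ) (ht : 0 ≤ t) : IsState (E t ρ) := (hE.cpt t ht).isState hρs
  have hE0 : E 0 ρ = ρ := by rw [hE.zero]; rfl
  have hder : HasDerivWithinAt (fun s => E s ρ) (L ρ) (Set.Ici 0) 0 := by
    have h := hE.deriv ρ 0 le_rfl
    rwa [hE0] at h
  have hLh : (L ρ).IsHermitian := isHermitian_deriv hder fun t ht => (hstate t ht).1.1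
  have hL0 : (L ρ).trace = 0 :=
    linearMap_deriv_eq_zero (Matrix.traceLinearMap n ℝ ℂ) (c := 1) hder
      fun t ht => (hstate t ht).2
  have hL0' : (L ρ).trace.re = 0 := by rw [hL0]; rfl
  obtain ⟨H, hH, rfl, htr⟩ := mem_gaussianStates_iff.1 hρ
  -- `A` is fixed by its quadratic moments alone, before any metric is chosen.
  obtain ⟨A, hA, hAm⟩ := exists_mem_tangentSpace_moments hH htr hL0'
  have hD : (A - L (NormedSpace.exp H)).IsHermitian :=
    (isHermitian_of_mem_tangentSpace hH htr hA).sub hLh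
  have horth (Z) (hZ : Z ∈ quadSpan a) : (Z * (A - L (NormedSpace.exp H))).trace = 0 :=
    trace_mul_eq_zero_of_mem_quadSpan ha hD
      (fun X hX => by rw [mul_sub, Matrix.trace_sub, Complex.sub_re, hAm X hX, sub_self]) hZ
  have horth' (k l) : (majorana a k * majorana a l * L (NormedSpace.exp H)).trace =
      (majorana a k * majorana a l * A).trace := by
    have h := horth _ (majorana_mul_mem_quadSpan a k l)
    rw [mul_sub, Matrix.trace_sub, sub_eq_zero] at h
    exact h.symm
  refine ⟨A, hA, fun Ω hΩ B => ?_, fun D b => ?_, ?_, ?_⟩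
  · exact (isMetricInto_of_mem_alphaMetrics ha hH htr hΩ).isTDVPProjection_iff hA hD horth B
  · have hsum (w : Fin D → ℝ) : ((∑ j, w j • b j : tangentSpace (gaussianStates a)
        (NormedSpace.exp H)) : Matrix n n ℂ) = ∑ j, w j • (b j : Matrix n n ℂ) := by
      simp
    have htrace (w : Fin D → ℝ) (X : Matrix n n ℂ) :
        (X * ∑ j, w j • (b j : Matrix n n ℂ)).trace = ∑ j, (w j : ℂ) * (X * b j).trace := by
      simp [Finset.mul_sum, Matrix.trace_sum]
    have hv : A = ∑ j, b.repr ⟨A, hA⟩ j • (b j : Matrix n n ℂ) := by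
      rw [← hsum, b.sum_repr]
    refine ⟨b.repr ⟨A, hA⟩, hv, fun w => ⟨fun hw => ?_, ?_⟩⟩
    · have hBw := (∑ j, w j • b j : tangentSpace (gaussianStates a) (NormedSpace.exp H)).2
      have hdiff := sub_mem hA hBw
      -- A solution `w` gives a tangent vector with the quadratic moments of `A`, hence `A` itself.
      have hAw : A = (∑ j, w j • b j : tangentSpace (gaussianStates a) (NormedSpace.exp H)) := by
        refine eq_of_moments_eq_of_mem_tangentSpace hH htr hA hBw fun X hX => ?_
        have h0 := trace_mul_eq_zero_of_majorana (a := a)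
          (trace_eq_zero_of_mem_tangentSpace hH htr hdiff)
          (fun k l => by
            rw [mul_sub, Matrix.trace_sub, ← horth', hw k l, hsum, htrace, sub_self])
          (mem_quadSpan_of_mem_quadSpace hX)
        rw [mul_sub, Matrix.trace_sub, sub_eq_zero] at h0
        rw [h0]
      have hAw' : (⟨A, hA⟩ : tangentSpace (gaussianStates a) (NormedSpace.exp H)) =
          ∑ j, w j • b j := Subtype.ext hAw
      rw [hAw']
      exact (b.repr_sum_self w).symm
    · rintro rfl k l
      rw [horth', ← htrace, ← hv]
  · refine isGaussifiedVelocity_of_moments ha hH htr hA hL0' hAm hder hE0 ?_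
    filter_upwards [self_mem_nhdsWithin] with t ht using hstate t ht
  · refine isGaussifiedVelocity_of_moments ha hH htr hA hL0' hAm
      (hasDerivWithinAt_add_smul _ _ _) (by simp) ?_
    exact (eventually_isState_add_smul (isHermitian_of_mem_quadSpace hH) hρs.2 hLh
      hL0).filter_mono nhdsWithin_le_nhds
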